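/- **Theorem (Existence of solutions of the fully discrete scheme).** *Setting.* Let $d\in\{2,3\}$ and let $\Omega\subset\mathbb R^d$ be an open set whose closure is triangulated by a finite conforming simplicial mesh $\mathfrak T_h$ of $d$-simplices (in particular, $\Omega$ may be any bounded, simply connected Lipschitz polygon or polyhedron with a triangulation of mesh size $h$). Let $$\mathbb X_h=\{f\in H^1_0(\Omega;\mathbb R^{d\times d}): f_{ij}|_K\in P_1(K)\ \forall K\in\mathfrak T_h,\ 1\le i,j\le d\},\qquad \mathbb Y_h=\{v\in H^1_0(\Omega): v|_K\in P_1(K)\ \forall K\in\mathfrak T_h\},$$ and let $\mathbb W_h=\{v\in H^1(\Omega): v|_K\in P_1(K)\ \forall K\in\mathfrak T_h\}$. Write $A:B=\sum_{ij}A_{ij}B_{ij}$, $(A)_S=\frac12(A+A^\top)$, $(A\odot B)_{ij}=A_{ij}B_{ij}$, $(\operatorname{div}Q)_i=\sum_j\partial_jQ_{ij}$, $\nabla P:\nabla Q=\sum_{ijk}\partial_kP_{ij}\,\partial_kQ_{ij}$. Let $a,b\in\mathbb R$, $c,L,M,R,\Delta t>0$, $\varepsilon_1,\varepsilon_2,\varepsilon_3\in\mathbb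 R$, $\beta_1\ge\max\{|b|,a\}$, $\beta_2\ge\max\{|b|,c\}$, and $$\frac{\partial\mathcal F_1(Q)}{\partial Q}=\beta_1Q-b\Big(Q^2-\tfrac1d\operatorname{tr}(Q^2)I\Big)+\beta_2\operatorname{tr}(Q^2)Q,\qquad \frac{\partial\mathcal F_2(Q)}{\partial Q}=(\beta_1-a)Q+(\beta_2-c)\operatorname{tr}(Q^2)Q .$$ For $\epsilon>0$ and a mollifier $\varphi_\epsilon$ (smooth, nonnegative, supported in $[-\epsilon,\epsilon]$, with integral $1$) let $\mathcal T_R(Q)_{ij}=\tau(Q_{ij})$, where $\tau(q)=\int_{\mathbb R}\varphi_\epsilon(q-y)\widehat{\mathcal T}_R(y)\,dy$, $\widehat{\mathcal T}_R(y)=\frac Rd\frac{y}{|y|}$ if $|y|>\frac Rd-\epsilon$ and $\widehat{\mathcal T}_R(y)=y$ otherwise (with $\frac{y}{|y|}=0$ at $y=0$). Let $\tilde P(Q',Q)_{ij}=\frac{\tau(Q'_{ij})-\tau(Q_{ij})}{Q'_{ij}-Q_{ij}}$ if $Q'_{ij}\neq Q_{ij}$ and $\tilde P(Q',Q)_{ij}=\tau'(Q_{ij})$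 otherwise. Let $N\in\mathbb N$ and let $\tilde g_h^0,\dots,\tilde g_h^N\in\mathbb W_h$ be the discrete boundary data (arbitrary elements of $\mathbb W_h$). Given $(Q_h^n,\tilde u_h^n)$, one step of the scheme asks for $Q_h^{n+1}\in\mathbb X_h$, $\tilde u_h^{n+1}\in\mathbb Y_h$ such that, with $u_h^m=\tilde u_h^m+\tilde g_h^m$, $Q_h^{n+1/2}=\frac12(Q_h^n+Q_h^{n+1})$, $u_h^{n+1/2}=\frac12(u_h^n+u_h^{n+1})$ and $A=\tilde P(Q_h^{n+1},Q_h^n)\odot\nabla u_h^n(\nabla u_h^{n+1})^\top$, $$\begin{aligned}-\int_\Omega\frac{Q_h^{n+1}-Q_h^n}{\Delta t}:\Phi_h\,dx&=ML\int_\Omega\nabla Q_h^{n+1/2}:\nabla\Phi_h\,dx+M\int_\Omega\Big(\frac{\partial\mathcal F_1(Q_h^{n+1})}{\partial Q}-\frac{\partial\mathcal F_2(Q_h^n)}{\partial Q}\Big):\Phi_h\,dx\\&\quad-\frac{M\varepsilon_2}2\int_\Omega\Big((A)_S-\tfrac1d\operatorname{tr}(A)I\Big):\Phi_h\,dx\\&\quad-M\varepsilon_3\int_\Omega\Big(\nabla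 u_h^{n+1/2}\cdot\operatorname{div}((\Phi_h)_S)-\tfrac1d\nabla u_h^{n+1/2}\cdot\nabla\operatorname{tr}\Phi_h\Big)dx\end{aligned}$$ for all $\Phi_h\in\mathbb X_h$, and $$\int_\Omega\big(\varepsilon_1\nabla u_h^{n+1}+\varepsilon_2\mathcal T_R(Q_h^{n+1})\nabla u_h^{n+1}+\varepsilon_3\operatorname{div}(Q_h^{n+1})\big)\cdot\nabla\psi_h\,dx=0$$ for all $\psi_h\in\mathbb Y_h$. *Statement.* Let $C>0$ be a constant such that $\|\operatorname{div}\Phi_h\|_{L^2(\Omega)}^2\le C\|\nabla\Phi_h\|_{L^2(\Omega)}^2$ for all $\Phi_h\in\mathbb X_h$ (for instance $C=d$), and suppose that $$\varepsilon_1>\max\{2|\varepsilon_2|(R+R^2),\,2|\varepsilon_3|\}\qquad\text{and}\qquad|\varepsilon_3|<\frac{L}{3C}.$$ Then: 1. For every $0\le n<N$, every $Q_h^n\in\mathbb X_h$ with symmetric trace-free values and every $\tilde u_h^n\in\mathbb Y_h$, the step of the scheme from time $n$ to time $n+1$ has a solution $(Q_h^{n+1},\tilde u_h^{n+1})\in\mathbb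 X_h\times\mathbb Y_h$, and it can be chosen with $Q_h^{n+1}$ symmetric and trace-free. 2. Consequently, for every $Q_h^0\in\mathbb X_h$ with symmetric trace-free values and every $\tilde u_h^0\in\mathbb Y_h$ there are $(Q_h^n,\tilde u_h^n)\in\mathbb X_h\times\mathbb Y_h$, $n=1,\dots,N$, that solve the scheme at all $N$ time steps. -/

import Mathlib

open MeasureTheory Filter Topology Matrix

namespace QTensorScheme

noncomputable section

/-- Euclidean space of dimension `d`. -/
abbrev Pt (d : ℕ) : Type := EuclideanSpace ℝ (Fin d)

/-- Real `d × d` matrices, used only as an array of entries (no norm is put on them). -/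
abbrev Mat (d : ℕ) : Type := Matrix (Fin d) (Fin d) ℝ

/-- The `k`-th partial derivative of `v` at `x`. -/
def pd {d : ℕ} (k : Fin d) (v : Pt d → ℝ) (x : Pt d) : ℝ :=
  fderiv ℝ v x (EuclideanSpace.single k 1)

/-! ### Sobolev spaces -/

/-- Smooth functions with compact support contained in `Ω`. -/
structure IsTestFunction {d : ℕ} (Ω : Set (Pt d)) (φ : Pt d → ℝ) : Prop where
  smooth : ContDiff ℝ (⊤ : ℕ∞) φ
  compact : HasCompactSupport φ
  subset : tsupport φ ⊆ Ω

/-- `w` is a weak `k`-th partial derivative of `v` in `Ω`. -/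
def HasWeakPartial {d : ℕ} (Ω : Set (Pt d)) (k : Fin d) (v w : Pt d → ℝ) : Prop :=
  ∀ φ : Pt d → ℝ, IsTestFunction Ω φ →
    ∫ x in Ω, v x * pd k φ x = - ∫ x in Ω, w x * φ x

/-- `v ∈ H¹(Ω)`: `v` and all its weak first partial derivatives are in `L²(Ω)`. -/
def MemH1 {d : ℕ} (Ω : Set (Pt d)) (v : Pt d → ℝ) : Prop :=
  MemLp v 2 (volume.restrict Ω) ∧
    ∀ k : Fin d, ∃ w : Pt d → ℝ, MemLp w 2 (volume.restrict Ω) ∧ HasWeakPartial Ω k v w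

/-- `v ∈ H₀¹(Ω)`: `v ∈ H¹(Ω)` is a limit, in the norm of `H¹(Ω)`, of smooth functions with compact
support in `Ω`. -/
def MemH10 {d : ℕ} (Ω : Set (Pt d)) (v : Pt d → ℝ) : Prop :=
  MemH1 Ω v ∧ ∃ φ : ℕ → Pt d → ℝ, (∀ m, IsTestFunction Ω (φ m)) ∧
    Tendsto (fun m => eLpNorm (fun x => φ m x - v x) 2 (volume.restrict Ω)) atTop (𝓝 0) ∧
    ∀ k : Fin d, ∃ w : Pt d → ℝ, MemLp w 2 (volume.restrict Ω) ∧ HasWeakPartial Ω k v w ∧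
      Tendsto (fun m => eLpNorm (fun x => pd k (φ m) x - w x) 2 (volume.restrict Ω)) atTop (𝓝 0)

/-! ### Triangulations and finite element spaces -/

/-- The complex `𝒯` is a (conforming) triangulation of `Ω`: it is finite, each of its simplices is
a face of one of dimension `d`, and its simplices cover exactly the closure of `Ω`. -/
structure IsTriangulation {d : ℕ} (𝒯 : Geometry.SimplicialComplex ℝ (Pt d)) (Ω : Set (Pt d)) :
    Prop where
  finite : 𝒯.faces.Finite
  pure : ∀ s ∈ 𝒯.faces, ∃ t ∈ 𝒯.faces, s ⊆ t ∧ t.card = d + 1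
  space_eq : 𝒯.space = closure Ω

/-- The restriction of `v` to every closed `d`-dimensional simplex of `𝒯` is a polynomial of degree
at most one. Such a `v` is differentiable in the interior of every simplex, so that `pd k v` is,
almost everywhere in the triangulated set, the weak partial derivative of `v`. -/
def IsPiecewiseP1 {d : ℕ} (𝒯 : Geometry.SimplicialComplex ℝ (Pt d)) (v : Pt d → ℝ) : Prop :=
  ∀ s ∈ 𝒯.faces, s.card = d + 1 →
    ∃ p : Pt d →ᵃ[ℝ] ℝ, ∀ x ∈ convexHull ℝ (s : Set (Pt d)), v x = p x

/-- The piecewise linear functions in `H¹(Ω)`. -/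
def Wh {d : ℕ} (Ω : Set (Pt d)) (𝒯 : Geometry.SimplicialComplex ℝ (Pt d)) : Set (Pt d → ℝ) :=
  {v | MemH1 Ω v ∧ IsPiecewiseP1 𝒯 v}

/-- The piecewise linear functions in `H₀¹(Ω)`. -/
def Yh {d : ℕ} (Ω : Set (Pt d)) (𝒯 : Geometry.SimplicialComplex ℝ (Pt d)) : Set (Pt d → ℝ) :=
  {v | MemH10 Ω v ∧ IsPiecewiseP1 𝒯 v}

/-- The matrix fields all of whose entries are piecewise linear functions in `H₀¹(Ω)`. -/
def Xh {d : ℕ} (Ω : Set (Pt d)) (𝒯 : Geometry.SimplicialComplex ℝ (Pt d)) : Set (Pt d → Mat d) :=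
  {Q | ∀ i j, MemH10 Ω (fun x => Q x i j) ∧ IsPiecewiseP1 𝒯 (fun x => Q x i j)}

/-- `Q` takes values in the symmetric trace-free matrices on `Ω`. -/
def IsQTensor {d : ℕ} (Ω : Set (Pt d)) (Q : Pt d → Mat d) : Prop :=
  ∀ x ∈ Ω, (Q x).IsSymm ∧ (Q x).trace = 0

/-! ### Algebra and differential operators -/

/-- The Frobenius inner product `A : B`. -/
def frob {d : ℕ} (A B : Mat d) : ℝ := ∑ i, ∑ j, A i j * B i j

/-- The symmetric part of a matrix. -/
def symPart {d : ℕ} (A : Mat d) : Mat d := (1 / 2 : ℝ) • (A + Aᵀ)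

/-- The gradient of a scalar function. -/
def grad {d : ℕ} (v : Pt d → ℝ) (x : Pt d) : Fin d → ℝ := fun k => pd k v x

/-- The row-wise divergence `(div Q)ᵢ = ∑ⱼ ∂ⱼ Qᵢⱼ`. -/
def divM {d : ℕ} (Q : Pt d → Mat d) (x : Pt d) : Fin d → ℝ :=
  fun i => ∑ j, pd j (fun y => Q y i j) x

/-- `∇P : ∇Q = ∑ᵢⱼₖ ∂ₖ Pᵢⱼ ∂ₖ Qᵢⱼ`. -/
def gradM {d : ℕ} (P Q : Pt d → Mat d) (x : Pt d) : ℝ :=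
  ∑ i, ∑ j, ∑ k, pd k (fun y => P y i j) x * pd k (fun y => Q y i j) x

/-! ### The truncation operator -/

/-- A mollifier of radius `ε`. -/
structure IsMollifier (φ : ℝ → ℝ) (ε : ℝ) : Prop where
  smooth : ContDiff ℝ (⊤ : ℕ∞) φ
  nonneg : ∀ y, 0 ≤ φ y
  support : ∀ y, φ y ≠ 0 → |y| ≤ ε
  integral : ∫ y, φ y = 1

/-- The parameters of the model and of the scheme. Here `eps` is the radius of the mollifier `φ`
and `dt` the time step. -/
structure Params where
  (a b c L M ε₁ ε₂ ε₃ β₁ β₂ R eps dt : ℝ)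
  φ : ℝ → ℝ

/-- The scalar truncation before mollification. -/
def truncHat (R eps : ℝ) (d : ℕ) (y : ℝ) : ℝ :=
  if R / d - eps < |y| then R / d * (y / |y|) else y

/-- The mollified scalar truncation. -/
def trunc (p : Params) (d : ℕ) (q : ℝ) : ℝ := ∫ y, p.φ (q - y) * truncHat p.R p.eps d y

/-- The truncation operator `𝒯_R` on matrices, which acts entrywise. -/
def truncM {d : ℕ} (p : Params) (Q : Mat d) : Mat d := Matrix.of fun i j => trunc p d (Q i j)

/-- The entrywise difference quotient `P̃(Q', Q)` of the truncation operator. -/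
def Ptilde {d : ℕ} (p : Params) (Q' Q : Mat d) : Mat d := Matrix.of fun i j =>
  if Q' i j - Q i j ≠ 0 then (truncM p Q' i j - truncM p Q i j) / (Q' i j - Q i j)
  else deriv (trunc p d) (Q i j)

/-! ### The convex splitting of the bulk potential -/

/-- `∂ℱ₁/∂Q`, where `ℱ₁(Q) = (β₁/2) tr(Q²) - (b/3) tr(Q³) + (β₂/4) tr(Q²)² + A₀` and the
derivative is taken along the trace-free symmetric matrices. -/
def dF1 {d : ℕ} (p : Params) (Q : Mat d) : Mat d :=
  p.β₁ • Q - p.b • (Q * Q - ((1 / d : ℝ) * (Q * Q).trace) • (1 : Mat d))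
    + (p.β₂ * (Q * Q).trace) • Q

/-- `∂ℱ₂/∂Q`, where `ℱ₂(Q) = ((β₁ - a)/2) tr(Q²) + ((β₂ - c)/4) tr(Q²)²`. -/
def dF2 {d : ℕ} (p : Params) (Q : Mat d) : Mat d :=
  (p.β₁ - p.a) • Q + ((p.β₂ - p.c) * (Q * Q).trace) • Q

/-! ### The scheme -/

/-- The discrete evolution equation for one time step: `(Q, u)` are the old and `(Q', u')` the new
tensor field and (full) electric potential. -/
def QEquation {d : ℕ} (p : Params) (Ω : Set (Pt d)) (𝒯 : Geometry.SimplicialComplex ℝ (Pt d))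
    (Q Q' : Pt d → Mat d) (u u' : Pt d → ℝ) : Prop :=
  ∀ Φ ∈ Xh Ω 𝒯,
    - ∫ x in Ω, frob ((1 / p.dt) • (Q' x - Q x)) (Φ x) =
      p.M * p.L * (∫ x in Ω, gradM (fun y => (1 / 2 : ℝ) • (Q y + Q' y)) Φ x)
      + p.M * (∫ x in Ω, frob (dF1 p (Q' x) - dF2 p (Q x)) (Φ x))
      - p.M * p.ε₂ / 2 * (∫ x in Ω,
          frob (symPart (Ptilde p (Q' x) (Q x) ⊙ vecMulVec (grad u x) (grad u' x))
            - ((1 / d : ℝ) * (Ptilde p (Q' x) (Q x) ⊙ vecMulVec (grad u x) (grad u' x)).trace)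
              • (1 : Mat d)) (Φ x))
      - p.M * p.ε₃ * (∫ x in Ω,
          ((grad (fun y => (u y + u' y) / 2) x ⬝ᵥ divM (fun y => symPart (Φ y)) x)
            - (1 / d : ℝ)
              * (grad (fun y => (u y + u' y) / 2) x ⬝ᵥ grad (fun y => (Φ y).trace) x)))

/-- The discrete elliptic equation for the tensor field `Q` and the (full) potential `u`. -/
def uEquation {d : ℕ} (p : Params) (Ω : Set (Pt d)) (𝒯 : Geometry.SimplicialComplex ℝ (Pt d))
    (Q : Pt d → Mat d) (u : Pt d → ℝ) : Prop :=
  ∀ ψ ∈ Yh Ω 𝒯,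
    ∫ x in Ω, ((p.ε₁ • grad u x + p.ε₂ • (truncM p (Q x) *ᵥ grad u x) + p.ε₃ • divM Q x)
      ⬝ᵥ grad ψ x) = 0

/-- `(Q', v')` is obtained from `(Q, v)` by one time step of the scheme, where `v`, `v'` are the
parts in `Y_h` of the potentials `u = v + g`, `u' = v' + g'`, and `g`, `g'` are the discrete
boundary data at the old and at the new time. -/
def IsStep {d : ℕ} (p : Params) (Ω : Set (Pt d)) (𝒯 : Geometry.SimplicialComplex ℝ (Pt d))
    (g g' : Pt d → ℝ) (Q : Pt d → Mat d) (v : Pt d → ℝ) (Q' : Pt d → Mat d) (v' : Pt d → ℝ) :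
    Prop :=
  Q' ∈ Xh Ω 𝒯 ∧ v' ∈ Yh Ω 𝒯 ∧
    QEquation p Ω 𝒯 Q Q' (fun x => v x + g x) (fun x => v' x + g' x) ∧
    uEquation p Ω 𝒯 Q' (fun x => v' x + g' x)

end

end QTensorScheme

namespace QTensorScheme

noncomputable section

/-! ### Zeros of continuous vector fields on a ball -/

section Brouwer

open Metric Set
open scoped NNReal RealInnerProductSpace

variable {E : Type*} [NormedAddCommGroup E] [InnerProductSpace ℝ E] [FiniteDimensional ℝ E]

/-! Fix the old data of a time step. Adding the two weak equations, the elliptic one with weight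
`M/2`, gives a single system: find `x` in a finite-dimensional space of coefficients with `B x y =
0` for all `y`, where `B x` is linear and depends continuously on `x`. Brouwer's theorem, in the
form that a continuous vector field pointing outwards on a sphere has a zero
(`exists_zero_of_inner_pos`), solves such a system as soon as `B x x` is coercive
(`exists_zero_of_coercive`).

Coercivity is proved pointwise, for the integrand (`exists_stepForm_coercive`). On the diagonal the
time difference and the elastic term control `Q'` and its gradient up to data. The convex part of
the bulk force has a sign because `β₁, β₂ ≥ |b|`. The weight `M/2` makes the `ε₃` couplings between
the unknowns cancel. The truncated matrix has operator norm at most `R`, so the elliptic term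
dominates `(ε₁ - |ε₂| R) |∇v'|²` up to data. The remaining `ε₂` coupling contains `Q'` only through
the products of the entries of `P̃(Q', Q)` and `Q'`: a difference quotient of a bounded `C¹`
function times its argument, which is bounded when `Q` is (`exists_bound_dslope_mul`). That coupling
therefore grows at most linearly in `∇v'`, and Young's inequality absorbs it.

Symmetry and vanishing trace are built in by projecting arbitrary coefficient matrices with `tfSym`.
The projection is self-adjoint for the Frobenius product and all forces lie in its range, so testing
with projected fields is the same as testing with all of `X_h`. The solution is again an admissible
initial state, and the steps can be iterated. -/

/-- `det (1 + t A)` is a polynomial in `t` of degree at most the dimension. -/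
theorem exists_polynomial_det_one_add_smul (A : E →L[ℝ] E) :
    ∃ P : Polynomial ℝ, P.natDegree ≤ Module.finrank ℝ E ∧
      ∀ t : ℝ, P.eval t = (1 + t • A : E →L[ℝ] E).det := by
  let b := Module.finBasis ℝ E
  let a := LinearMap.toMatrix b b (A : E →ₗ[ℝ] E)
  refine ⟨_, (Polynomial.natDegree_det_X_add_C_le a 1).trans (by simp), fun t => ?_⟩
  rw [← Polynomial.coe_evalRingHom, RingHom.map_det, ContinuousLinearMap.det,
    ← LinearMap.det_toMatrix b]
  congr 1
  have h : LinearMap.toMatrix b b ((1 + t • A : E →L[ℝ] E) : E →ₗ[ℝ] E) = 1 + t • a := by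
    rw [← LinearMap.toMatrix_one b, ← map_smul, ← map_add]
    rfl
  rw [h]
  ext i j
  simp [Matrix.one_apply, apply_ite, add_comm, smul_eq_mul]
  ring

/-- Lagrange interpolation of `det (1 + t A)`, with weights that do not depend on `A`. -/
theorem exists_weights_det_one_add {t₀ : ℝ} (ht₀ : 0 < t₀) :
    ∃ (n : ℕ) (t w : Fin n → ℝ), (∀ i, 0 < t i ∧ t i < t₀) ∧ ∑ i, w i = 1 ∧
      ∀ A : E →L[ℝ] E, (1 + A).det = ∑ i, w i * (1 + t i • A).det := by
  -- One node more than the degree bound, so interpolation is exact. The offset `2` keeps every node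
  -- strictly below `t₀`, also at index `0`; the weights are the Lagrange basis polynomials
  -- evaluated at `1`.
  set n := Module.finrank ℝ E + 1
  let t : Fin n → ℝ := fun i => t₀ / ((i : ℝ) + 2)
  have htinj : Function.Injective t := by
    intro i j h
    have hi : (0 : ℝ) < (i : ℝ) + 2 := by positivity
    have hj : (0 : ℝ) < (j : ℝ) + 2 := by positivity
    have h' : t₀ / ((i : ℝ) + 2) = t₀ / ((j : ℝ) + 2) := h
    rw [div_eq_div_iff hi.ne' hj.ne'] at h'
    have := mul_left_cancel₀ ht₀.ne' h'
    exact Fin.ext (by exact_mod_cast (add_right_cancel this).symm)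
  refine ⟨n, t, fun i => (Lagrange.basis Finset.univ t i).eval 1, fun i => ⟨?_, ?_⟩, ?_, fun A => ?_⟩
  · positivity
  · exact div_lt_self ht₀ (by linarith [Nat.cast_nonneg (α := ℝ) (i : ℕ)])
  · rw [← Polynomial.eval_finsetSum, Lagrange.sum_basis htinj.injOn Finset.univ_nonempty,
      Polynomial.eval_one]
  · obtain ⟨P, hP, hPe⟩ := exists_polynomial_det_one_add_smul A
    have hdeg : P.degree < (Finset.univ : Finset (Fin n)).card := by
      rw [Finset.card_univ, Fintype.card_fin]
      exact (Polynomial.degree_le_natDegree).trans_lt (by exact_mod_cast Nat.lt_succ_of_le hP)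
    have h1 := congrArg (Polynomial.eval 1) (Lagrange.eq_interpolate htinj.injOn hdeg)
    rw [hPe, Lagrange.interpolate_apply, Polynomial.eval_finsetSum, one_smul] at h1
    rw [h1]
    refine Finset.sum_congr rfl fun i _ => ?_
    rw [Polynomial.eval_mul, Polynomial.eval_C, hPe, mul_comm]

/-- Along the segment `1 + s A` every operator is invertible by the Neumann series, so the
determinant cannot change sign on its way from `det 1 = 1`. -/
theorem det_one_add_pos {A : E →L[ℝ] E} (hA : ‖A‖ < 1) : 0 < (1 + A).det := by
  have hcont : ContinuousOn (fun s : ℝ => (1 + s • A : E →L[ℝ] E).det) (Icc 0 1) := by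
    apply Continuous.continuousOn
    exact ContinuousLinearMap.continuous_det.comp (by fun_prop)
  have hne : ∀ s ∈ Icc (0 : ℝ) 1, (1 + s • A : E →L[ℝ] E).det ≠ 0 := by
    intro s hs h0
    have hu : IsUnit (1 + s • A : E →L[ℝ] E) := by
      have : ‖-(s • A)‖ < 1 := by
        rw [norm_neg, norm_smul, Real.norm_of_nonneg hs.1]
        exact (mul_le_of_le_one_left (norm_nonneg _) hs.2).trans_lt hA
      simpa using isUnit_one_sub_of_norm_lt_one this
    have h2 : IsUnit ((1 + s • A : E →L[ℝ] E) : E →ₗ[ℝ] E) :=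
      hu.map (ContinuousLinearMap.toLinearMapRingHom (R₁ := ℝ) (M₁ := E))
    exact (h2.map (LinearMap.det (M := E) (A := ℝ))).ne_zero h0
  by_contra! hle
  have h0 : (1 + (0 : ℝ) • A : E →L[ℝ] E).det = 1 := by simp [ContinuousLinearMap.det]
  have : (0 : ℝ) ∈ Icc ((1 + (1 : ℝ) • A : E →L[ℝ] E).det) ((1 + (0 : ℝ) • A : E →L[ℝ] E).det) :=
    ⟨by simpa using hle, by rw [h0]; exact zero_le_one⟩
  obtain ⟨s, hs, hs0⟩ := intermediate_value_Icc' zero_le_one hcont this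
  exact hne s hs hs0

/-- For small `t` the map `x + t (f x - x)` is a perturbation of the identity with Lipschitz
constant below one, hence injective and open. It fixes the sphere and sends the ball into itself, so
its image is both open and relatively closed in the connected ball. -/
theorem image_ball_of_lipschitzOnWith [Nontrivial E] {f : E → E} {K : ℝ≥0}
    (hg : LipschitzOnWith K (fun x => f x - x) (closedBall 0 1))
    (hmap : ∀ x ∈ closedBall (0 : E) 1, f x ∈ closedBall 0 1)
    (hid : ∀ x ∈ sphere (0 : E) 1, f x = x) {t : ℝ} (ht0 : 0 < t) (ht1 : t < 1) (htK : t * K < 1) :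
    InjOn (fun x => x + t • (f x - x)) (ball 0 1) ∧
      (fun x => x + t • (f x - x)) '' ball 0 1 = ball 0 1 := by
  set F : E → E := fun x => x + t • (f x - x) with hF
  have happ : ApproximatesLinearOn F ((ContinuousLinearEquiv.refl ℝ E : E ≃L[ℝ] E) : E →L[ℝ] E)
      (closedBall 0 1) (⟨t, ht0.le⟩ * K) := by
    intro x hx y hy
    have h1 := hg.norm_sub_le hx hy
    have : F x - F y - ((ContinuousLinearEquiv.refl ℝ E : E ≃L[ℝ] E) : E →L[ℝ] E) (x - y)
        = t • ((f x - x) - (f y - y)) := by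
      simp only [hF, ContinuousLinearEquiv.coe_refl, ContinuousLinearMap.coe_id', id]
      module
    rw [this, norm_smul, Real.norm_of_nonneg ht0.le]
    calc t * ‖f x - x - (f y - y)‖ ≤ t * (K * ‖x - y‖) := by gcongr
      _ = _ := by rw [← mul_assoc]; rfl
  have hc : (⟨t, ht0.le⟩ * K : ℝ≥0) < 1 := by
    rw [← NNReal.coe_lt_coe]; exact htK
  have hcl : IsCompact (F '' closedBall 0 1) :=
    (isCompact_closedBall 0 1).image_of_continuousOn happ.continuousOn
  have hnorm : ∀ x ∈ ball (0 : E) 1, F x ∈ ball (0 : E) 1 := by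
    intro x hx
    rw [mem_ball_zero_iff] at hx ⊢
    have hfx := hmap x (ball_subset_closedBall (by simpa using hx))
    rw [mem_closedBall_zero_iff] at hfx
    have : F x = (1 - t) • x + t • f x := by simp only [hF]; module
    rw [this]
    calc ‖(1 - t) • x + t • f x‖ ≤ (1 - t) * ‖x‖ + t * ‖f x‖ := by
          refine (norm_add_le _ _).trans (le_of_eq ?_)
          rw [norm_smul, norm_smul, Real.norm_of_nonneg ht0.le, Real.norm_of_nonneg (by linarith)]
      _ < 1 := by nlinarith
  have hsph : ∀ x ∈ sphere (0 : E) 1, F x = x := fun x hx => by simp [hF, hid x hx]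
  -- Sphere points are fixed and so contribute nothing inside the open ball: the image is the trace
  -- of a compact set, hence relatively closed.
  have heq : F '' ball 0 1 = F '' closedBall 0 1 ∩ ball 0 1 := by
    ext y
    constructor
    · rintro ⟨x, hx, rfl⟩
      exact ⟨⟨x, ball_subset_closedBall hx, rfl⟩, hnorm x hx⟩
    · rintro ⟨⟨x, hx, rfl⟩, hy⟩
      rcases (mem_closedBall_zero_iff.1 hx).lt_or_eq with h | h
      · exact ⟨x, by simpa using h, rfl⟩
      · rw [hsph x (by simpa using h)] at hy
        simp only [mem_ball_zero_iff] at hy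
        exact absurd h hy.ne
  have hone : ‖((ContinuousLinearEquiv.refl ℝ E).symm : E →L[ℝ] E)‖₊ = 1 := by
    rw [← NNReal.coe_inj]
    simp
  have hopen : IsOpen (F '' ball 0 1) := by
    refine (happ.mono_set ball_subset_closedBall).open_image
      (ContinuousLinearEquiv.refl ℝ E).toNonlinearRightInverse isOpen_ball (Or.inr ?_)
    change _ < (‖((ContinuousLinearEquiv.refl ℝ E).symm : E →L[ℝ] E)‖₊)⁻¹
    rw [hone]
    simpa using hc
  refine ⟨(happ.mono_set ball_subset_closedBall).injOn (Or.inr ?_), ?_⟩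
  · rw [hone]
    simpa using hc
  · have hpre : IsPreconnected (ball (0 : E) 1) := (convex_ball 0 1).isPreconnected
    refine Subset.antisymm (by rintro _ ⟨x, hx, rfl⟩; exact hnorm x hx) ?_
    have := hpre.subset_of_closure_inter_subset hopen
      ⟨F 0, hnorm 0 (by simp), 0, by simp, rfl⟩ (by
        have hcl' : closure (F '' ball 0 1) ⊆ F '' closedBall 0 1 :=
          closure_minimal (image_mono ball_subset_closedBall) hcl.isClosed
        rw [heq]
        exact inter_subset_inter_left _ (by rw [← heq]; exact hcl'))
    exact this

/-- There is no continuously differentiable retraction of the closed unit ball onto the sphere. -/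
theorem no_retraction [Nontrivial E] [MeasurableSpace E] [BorelSpace E] {f : E → E} {U : Set E}
    (hU : IsOpen U) (hBU : closedBall 0 1 ⊆ U) (hf : ContDiffOn ℝ 1 f U)
    (hmap : ∀ x ∈ closedBall (0 : E) 1, ‖f x‖ = 1)
    (hid : ∀ x ∈ sphere (0 : E) 1, f x = x) : False := by
  let μ : Measure E := volume
  have hdiff : ∀ x ∈ closedBall (0 : E) 1, DifferentiableAt ℝ f x := fun x hx =>
    (hf.differentiableOn one_ne_zero).differentiableAt (hU.mem_nhds (hBU hx))
  let A : E → E →L[ℝ] E := fun x => fderiv ℝ f x - 1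
  have hAc : ContinuousOn A (closedBall 0 1) :=
    ((hf.continuousOn_fderiv_of_isOpen hU le_rfl).mono hBU).sub continuousOn_const
  have hAd : ∀ x ∈ closedBall (0 : E) 1, HasFDerivAt (fun x => f x - x) (A x) x := fun x hx =>
    (hdiff x hx).hasFDerivAt.sub (hasFDerivAt_id x)
  obtain ⟨K₀, hK₀⟩ := (isCompact_closedBall (0 : E) 1).exists_bound_of_continuousOn hAc
  let K : ℝ≥0 := ⟨max K₀ 0, le_max_right _ _⟩
  have hK : ∀ x ∈ closedBall (0 : E) 1, ‖A x‖ ≤ K := fun x hx => (hK₀ x hx).trans (le_max_left _ _)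
  have hlip : LipschitzOnWith K (fun x => f x - x) (closedBall 0 1) :=
    (convex_closedBall 0 1).lipschitzOnWith_of_nnnorm_hasFDerivWithin_le
      (fun x hx => (hAd x hx).hasFDerivWithinAt) (fun x hx => hK x hx)
  -- The bound `1 / (K + 1)` guarantees both `t i < 1` and `t i * K < 1` at each node.
  obtain ⟨n, t, w, ht, hw, hdet⟩ := exists_weights_det_one_add (E := E)
    (t₀ := 1 / (K + 1)) (by positivity)
  -- At each node the change of variables computes the volume of the image, which is the whole ball.
  -- Interpolation carries this value to parameter `1`, where the determinant is that of `fderiv ℝ f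
  -- x`.
  have hint : ∀ i, ∫ x in ball (0 : E) 1, (1 + t i • A x).det ∂μ = μ.real (ball 0 1) := by
    intro i
    have hK1 : (0 : ℝ) < K + 1 := by positivity
    have htK : t i * (K + 1) < 1 := (lt_div_iff₀ hK1).1 (ht i).2
    have ht1 : t i < 1 := by nlinarith [(ht i).1, K.2, mul_nonneg (ht i).1.le K.2]
    obtain ⟨hinj, himg⟩ := image_ball_of_lipschitzOnWith hlip
      (fun x hx => by simp [hmap x hx]) hid (ht i).1 ht1 (by nlinarith [(ht i).1])
    have hcv := integral_image_eq_integral_abs_det_fderiv_smul μ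
      (measurableSet_ball (x := (0 : E)) (ε := 1)) (f := fun x => x + t i • (f x - x))
      (f' := fun x => 1 + t i • A x) (fun x hx =>
        ((hasFDerivAt_id x).add ((hAd x (ball_subset_closedBall hx)).const_smul
          (t i))).hasFDerivWithinAt) hinj (fun _ => (1 : ℝ))
    rw [himg] at hcv
    simp only [smul_eq_mul, mul_one, integral_const, MeasurableSet.univ, measureReal_restrict_apply,
      univ_inter] at hcv
    rw [hcv]
    refine setIntegral_congr_fun measurableSet_ball fun x hx => ?_
    refine (abs_of_pos (det_one_add_pos ?_)).symm
    rw [norm_smul, Real.norm_of_nonneg (ht i).1.le]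
    have := hK x (ball_subset_closedBall hx)
    nlinarith [(ht i).1]
  have hintble : ∀ i, IntegrableOn (fun x => w i * (1 + t i • A x).det) (ball (0 : E) 1) μ := by
    intro i
    refine (ContinuousOn.integrableOn_compact (isCompact_closedBall (0 : E) 1) ?_).mono_set
      ball_subset_closedBall
    have : ContinuousOn (fun x => 1 + t i • A x) (closedBall 0 1) :=
      continuousOn_const.add (hAc.const_smul (t i))
    exact continuousOn_const.mul (ContinuousLinearMap.continuous_det.comp_continuousOn this)
  -- Differentiating `‖f‖² = 1` shows that `f x` is orthogonal to the range of the derivative. An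
  -- invertible derivative would have `f x` itself in its range.
  have hzero : ∀ x ∈ ball (0 : E) 1, (1 + A x).det = 0 := by
    intro x hx
    have hA1 : 1 + A x = fderiv ℝ f x := by simp [A]
    rw [hA1]
    have hd := (hdiff x (ball_subset_closedBall hx)).hasFDerivAt
    have hconst : (fun y => ⟪f y, f y⟫) =ᶠ[𝓝 x] fun _ => (1 : ℝ) := by
      filter_upwards [isOpen_ball.mem_nhds hx] with y hy
      rw [real_inner_self_eq_norm_sq, hmap y (ball_subset_closedBall hy), one_pow]
    have hder := (hd.inner ℝ hd).unique ((hasFDerivAt_const (1 : ℝ) x).congr_of_eventuallyEq hconst)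
    by_contra hne
    have hu : IsUnit ((fderiv ℝ f x : E →L[ℝ] E) : E →ₗ[ℝ] E) :=
      (LinearMap.isUnit_iff_isUnit_det _).2 (isUnit_iff_ne_zero.2 hne)
    obtain ⟨v, hv⟩ := ((Module.End.isUnit_iff _).1 hu).2 (f x)
    have h2 := congrArg (fun L : E →L[ℝ] ℝ => L v) hder
    have hv' : fderiv ℝ f x v = f x := hv
    have h1 := hmap x (ball_subset_closedBall hx)
    simp [fderivInnerCLM_apply, hv', h1] at h2
  have hfinal : μ.real (ball (0 : E) 1) = 0 := by
    calc μ.real (ball (0 : E) 1) = ∑ i, w i * ∫ x in ball (0 : E) 1, (1 + t i • A x).det ∂μ := by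
          simp_rw [hint]
          rw [← Finset.sum_mul, hw, one_mul]
      _ = ∫ x in ball (0 : E) 1, ∑ i, w i * (1 + t i • A x).det ∂μ := by
          rw [integral_finsetSum _ fun i _ => hintble i]
          simp_rw [integral_const_mul]
      _ = ∫ x in ball (0 : E) 1, (0 : ℝ) ∂μ := by
          refine setIntegral_congr_fun measurableSet_ball fun x hx => ?_
          rw [← hdet, hzero x hx]
      _ = 0 := by simp
  rw [measureReal_eq_zero_iff (measure_ball_lt_top).ne] at hfinal
  exact (measure_ball_pos μ (0 : E) one_pos).ne' hfinal

/-- A continuous vector field that points outwards on the unit sphere has a zero. -/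
theorem exists_zero_of_inner_pos_unit [Nontrivial E] [MeasurableSpace E] [BorelSpace E]
    {F : E → E} (hF : Continuous F)
    (hpos : ∀ x, ‖x‖ = 1 → 0 < ⟪F x, x⟫) : ∃ x, F x = 0 := by
  by_contra! hne
  have hBc : IsCompact (closedBall (0 : E) 1) := isCompact_closedBall 0 1
  -- The factor `1 - ‖x‖²` makes this field the identity on the sphere, whatever replaces `F`. A
  -- zero would force `F x` to point against `x`, which is possible only on the compact set `S`
  -- below. There `‖x‖ < 1`, while for large `K` the first summand has norm at least one.
  obtain ⟨K, hKpos, hK⟩ : ∃ K : ℝ, 0 < K ∧ ∀ x ∈ closedBall (0 : E) 1,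
      (K * (1 - ‖x‖ ^ 2)) • F x + x ≠ 0 := by
    let S := closedBall (0 : E) 1 ∩ {x | ⟪F x, x⟫ ≤ 0}
    have hS : IsCompact S := hBc.inter_right (isClosed_le (by fun_prop) continuous_const)
    have h0S : (0 : E) ∈ S := ⟨by simp, by simp⟩
    obtain ⟨z, hz, hmin⟩ := hS.exists_isMinOn ⟨0, h0S⟩
      (f := fun x => (1 - ‖x‖ ^ 2) * ‖F x‖) (by fun_prop)
    have hltS : ∀ x ∈ S, ‖x‖ < 1 := fun x hx =>
      lt_of_le_of_ne (by simpa using hx.1) fun h => absurd (hpos x h) (not_lt.2 hx.2)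
    have hδ : 0 < (1 - ‖z‖ ^ 2) * ‖F z‖ := by
      have := hltS z hz
      exact mul_pos (by nlinarith [norm_nonneg z]) (norm_pos_iff.2 (hne z))
    set δ := (1 - ‖z‖ ^ 2) * ‖F z‖ with hδd
    refine ⟨1 / δ, by positivity, fun x hx h => ?_⟩
    have hx1 : ‖x‖ ≤ 1 := by simpa using hx
    have hfac : 0 ≤ 1 / δ * (1 - ‖x‖ ^ 2) := by
      have : 0 ≤ 1 - ‖x‖ ^ 2 := by nlinarith [norm_nonneg x]
      positivity
    by_cases hxS : x ∈ S
    · have h1 : ‖(1 / δ * (1 - ‖x‖ ^ 2)) • F x‖ = ‖x‖ := by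
        rw [eq_neg_of_add_eq_zero_left h, norm_neg]
      rw [norm_smul, Real.norm_of_nonneg hfac] at h1
      have h2 : δ ≤ (1 - ‖x‖ ^ 2) * ‖F x‖ := hmin hxS
      have h3 : 1 / δ * (1 - ‖x‖ ^ 2) * ‖F x‖ ≥ 1 := by
        rw [mul_assoc, ge_iff_le, one_div, ← div_eq_inv_mul, le_div_iff₀ hδ]; linarith
      linarith [hltS x hxS]
    · have hp : 0 < ⟪F x, x⟫ := by
        by_contra! hc
        exact hxS ⟨hx, hc⟩
      have h1 := congrArg (fun y => ⟪y, x⟫) h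
      simp only [inner_add_left, real_inner_smul_left, inner_zero_left,
        real_inner_self_eq_norm_sq] at h1
      have hx0 : x ≠ 0 := fun h0 => hxS (h0 ▸ h0S)
      have : 0 < ‖x‖ ^ 2 := by positivity
      nlinarith [mul_nonneg hfac hp.le]
  obtain ⟨z, hz, hmin⟩ := hBc.exists_isMinOn ⟨0, by simp⟩
    (f := fun x => ‖(K * (1 - ‖x‖ ^ 2)) • F x + x‖) (by fun_prop)
  set δ := ‖(K * (1 - ‖z‖ ^ 2)) • F z + z‖
  have hδ : 0 < δ := norm_pos_iff.2 (hK z hz)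
  -- The retraction argument needs a `C¹` field. An error below `δ / K` moves the combined field by
  -- less than its minimum norm `δ`, so it still has no zero.
  obtain ⟨G, hG, hGF, -⟩ := hF.exists_contDiff_approx 1 (ε := fun _ => δ / K)
    continuous_const (fun _ => by positivity)
  let H : E → E := fun x => (K * (1 - ‖x‖ ^ 2)) • G x + x
  have hH : ContDiff ℝ 1 H :=
    ((contDiff_const.mul (contDiff_const.sub (contDiff_norm_sq ℝ))).smul hG).add contDiff_id
  have hHne : ∀ x ∈ closedBall (0 : E) 1, H x ≠ 0 := by
    intro x hx h
    have hx1 : ‖x‖ ≤ 1 := by simpa using hx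
    have h1 : δ ≤ ‖(K * (1 - ‖x‖ ^ 2)) • F x + x‖ := hmin hx
    have h2 : (K * (1 - ‖x‖ ^ 2)) • F x + x = (K * (1 - ‖x‖ ^ 2)) • (F x - G x) := by
      have : (K * (1 - ‖x‖ ^ 2)) • F x + x = (K * (1 - ‖x‖ ^ 2)) • (F x - G x) + H x := by
        simp only [H]; module
      rw [this, h, add_zero]
    have h3 : ‖F x - G x‖ < δ / K := by
      rw [← dist_eq_norm, dist_comm]; exact hGF x
    have h4 : 0 ≤ K * (1 - ‖x‖ ^ 2) := mul_nonneg hKpos.le (by nlinarith [norm_nonneg x])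
    have h5 : K * (1 - ‖x‖ ^ 2) ≤ K := by nlinarith [sq_nonneg ‖x‖]
    rw [h2, norm_smul, Real.norm_of_nonneg h4] at h1
    have h6 : K * ‖F x - G x‖ < δ := by
      rw [mul_comm]; exact (lt_div_iff₀ hKpos).1 h3
    nlinarith [norm_nonneg (F x - G x)]
  refine no_retraction (f := fun x => ‖H x‖⁻¹ • H x) (U := {x | H x ≠ 0})
    (isOpen_ne_fun hH.continuous continuous_const) hHne ?_ ?_ ?_
  · intro x hx
    have : ContDiffAt ℝ 1 (fun x => ‖H x‖⁻¹ • H x) x :=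
      ((hH.contDiffAt.norm ℝ hx).inv (norm_ne_zero_iff.2 hx)).smul hH.contDiffAt
    exact this.contDiffWithinAt
  · intro x hx
    rw [norm_smul, norm_inv, norm_norm, inv_mul_cancel₀ (norm_ne_zero_iff.2 (hHne x hx))]
  · intro x hx
    have hx1 : ‖x‖ = 1 := by simpa using hx
    simp [H, hx1]

/-- A continuous vector field that points outwards on a sphere has a zero. -/
theorem exists_zero_of_inner_pos {F : E → E} (hF : Continuous F) {r : ℝ} (hr : 0 < r)
    (hpos : ∀ x, ‖x‖ = r → 0 < ⟪F x, x⟫) : ∃ x, F x = 0 := by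
  rcases subsingleton_or_nontrivial E with h | h
  · exact ⟨0, Subsingleton.elim _ _⟩
  borelize E
  obtain ⟨x, hx⟩ := exists_zero_of_inner_pos_unit (F := fun x => F (r • x)) (by fun_prop)
    (fun x hx => by
      have := hpos (r • x) (by rw [norm_smul, hx, mul_one, Real.norm_of_nonneg hr.le])
      rw [real_inner_smul_right] at this
      exact pos_of_mul_pos_right this hr.le)
  exact ⟨_, hx⟩

end Brouwer

/-! ### Galerkin systems and parametric integrals -/

/-- A coercive system of continuous equations in finite dimension has a solution. The coercivity is
measured by a quadratic functional `b` that may vanish on a subspace `N` of irrelevant directions. -/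
theorem exists_zero_of_coercive {V : Type*} [AddCommGroup V] [Module ℝ V] [TopologicalSpace V]
    [IsTopologicalAddGroup V] [ContinuousSMul ℝ V] [FiniteDimensional ℝ V]
    (B : V → V →ₗ[ℝ] ℝ) (hB : ∀ y, Continuous fun x => B x y)
    (N : Submodule ℝ V) (hN : ∀ x, ∀ n ∈ N, B x n = 0)
    (b : V → ℝ) (hbc : Continuous b) (hbh : ∀ (t : ℝ) x, b (t • x) = t ^ 2 * b x)
    (hbpos : ∀ x, x ∉ N → 0 < b x) {κ K : ℝ} (hκ : 0 < κ)
    (hco : ∀ x, κ * b x - K ≤ B x x) : ∃ x, ∀ y, B x y = 0 := by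
  -- The unknown is sought in a complement of `N`, where `b` is positive away from zero; test
  -- directions in `N` are satisfied automatically.
  obtain ⟨W, hW⟩ := N.exists_isCompl
  let n := Module.finrank ℝ W
  let e : EuclideanSpace ℝ (Fin n) ≃ₗ[ℝ] W := LinearEquiv.ofFinrankEq _ _ (by simp [n])
  let ι : EuclideanSpace ℝ (Fin n) →ₗ[ℝ] V := W.subtype ∘ₗ e.toLinearMap
  have hι : Continuous ι := LinearMap.continuous_of_finiteDimensional ι
  have hιN : ∀ z, z ≠ 0 → ι z ∉ N := by
    intro z hz hzN
    have h0 : ι z = 0 := by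
      have : ι z ∈ N ⊓ W := ⟨hzN, (e z).2⟩
      simpa [hW.inf_eq_bot] using this
    exact hz (by simpa [ι] using h0)
  let F : EuclideanSpace ℝ (Fin n) → EuclideanSpace ℝ (Fin n) := fun z => WithLp.toLp 2 fun i => B (ι z) (ι (EuclideanSpace.single i 1))
  have hF : Continuous F := by
    refine (PiLp.continuous_toLp 2 _).comp (continuous_pi fun i => ?_)
    exact (hB _).comp hι
  have hFinner : ∀ z y : EuclideanSpace ℝ (Fin n), inner ℝ (F z) y = B (ι z) (ι y) := by
    intro z y
    have hy : y = ∑ i, y i • EuclideanSpace.single i (1 : ℝ) := by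
      ext j
      simp [Finset.sum_apply, Pi.single_apply]
    conv_rhs => rw [hy]
    simp only [map_sum, map_smul, smul_eq_mul]
    simp [PiLp.inner_apply, F]
  have hzero : ∃ z, F z = 0 := by
    rcases subsingleton_or_nontrivial (EuclideanSpace ℝ (Fin n)) with h | h
    · exact ⟨0, Subsingleton.elim _ _⟩
    -- Quadratic homogeneity turns the minimum of `b` on the unit sphere into the bound `m ‖z‖² ≤ b
    -- (ι z)`.
    obtain ⟨z₀, hz₀, hmin⟩ := (isCompact_sphere (0 : EuclideanSpace ℝ (Fin n)) 1).exists_isMinOn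
      (NormedSpace.sphere_nonempty.2 zero_le_one) (hbc.comp hι).continuousOn
    set m := b (ι z₀) with hm
    have hz₀0 : z₀ ≠ 0 := by
      rintro rfl
      simp at hz₀
    have hmpos : 0 < m := hbpos _ (hιN z₀ hz₀0)
    have hbz : ∀ z, m * ‖z‖ ^ 2 ≤ b (ι z) := by
      intro z
      rcases eq_or_ne z 0 with rfl | hz
      · have hb0 : b 0 = 0 := by simpa using hbh 0 0
        simp [hb0]
      · have hzn : ‖z‖ ≠ 0 := norm_ne_zero_iff.2 hz
        have h1 : m ≤ b (ι (‖z‖⁻¹ • z)) := hmin (show ‖z‖⁻¹ • z ∈ Metric.sphere (0 : EuclideanSpace ℝ (Fin n)) 1 by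
          simp [norm_smul, hzn])
        have h2 : z = ‖z‖ • (‖z‖⁻¹ • z) := by rw [smul_smul, mul_inv_cancel₀ hzn, one_smul]
        have h3 : b (ι z) = ‖z‖ ^ 2 * b (ι (‖z‖⁻¹ • z)) := by
          conv_lhs => rw [h2]
          rw [map_smul, hbh]
        rw [h3, mul_comm]
        gcongr
    -- With `r = s + 1` and `s = |K| / (κ m)`, the quantity `κ m r²` exceeds `2 κ m s = 2 |K|`,
    -- which beats `K`.
    refine exists_zero_of_inner_pos hF (r := |K| / (κ * m) + 1) (by positivity) fun z hz => ?_
    rw [hFinner]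
    have h1 := hco (ι z)
    have h2 := hbz z
    rw [hz] at h2
    have h3 : 0 ≤ |K| / (κ * m) := by positivity
    have h4 : κ * m * (|K| / (κ * m)) = |K| := by field_simp
    have h5 : κ * (m * (|K| / (κ * m) + 1) ^ 2) ≤ κ * b (ι z) := by gcongr
    have h6 : 0 < κ * m := by positivity
    nlinarith [le_abs_self K, mul_nonneg h6.le h3, mul_nonneg h6.le (sq_nonneg (|K| / (κ * m)))]
  obtain ⟨z, hz⟩ := hzero
  refine ⟨ι z, fun y => ?_⟩
  obtain ⟨a, ha, w, hw, rfl⟩ := Submodule.mem_sup.1 (hW.sup_eq_top ▸ Submodule.mem_top : y ∈ N ⊔ W)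
  have hw' : ι (e.symm ⟨w, hw⟩) = w := by simp [ι]
  rw [map_add, hN _ _ ha, zero_add, ← hw', ← hFinner, hz, inner_zero_left]

section Parametric

variable {X H : Type*} [MeasurableSpace X] {μ : Measure X}
  [NormedAddCommGroup H] [NormedSpace ℝ H] [FiniteDimensional ℝ H]

theorem exists_bound_comp {h : X → H} {R : ℝ} (hR : ∀ᵐ x ∂μ, ‖h x‖ ≤ R) {f : H → ℝ}
    (hf : Continuous f) : ∃ K, ∀ᵐ x ∂μ, ‖f (h x)‖ ≤ K := by
  have : ProperSpace H := FiniteDimensional.proper_real H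
  obtain ⟨K, hK⟩ := (isCompact_closedBall (0 : H) R).exists_bound_of_continuousOn hf.continuousOn
  exact ⟨K, hR.mono fun x hx => hK _ (by simpa using hx)⟩

/-- A continuous function of a bounded measurable function is integrable. -/
theorem integrable_comp_of_bounded [IsFiniteMeasure μ] {h : X → H} (hh : AEStronglyMeasurable h μ) {R : ℝ}
    (hR : ∀ᵐ x ∂μ, ‖h x‖ ≤ R) {f : H → ℝ} (hf : Continuous f) : Integrable (fun x => f (h x)) μ := by
  obtain ⟨K, hK⟩ := exists_bound_comp hR hf
  exact Integrable.of_bound (hf.comp_aestronglyMeasurable hh) K hK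

/-- Almost all values of `h` lie in one closed ball. On its product with a compact neighbourhood of
the parameter the integrand is bounded, and a constant is a dominating function for a finite
measure. -/
theorem continuous_integral_of_bounded [IsFiniteMeasure μ] {V : Type*} [TopologicalSpace V] [LocallyCompactSpace V]
    [FirstCountableTopology V] {h : X → H} (hh : AEStronglyMeasurable h μ) {R : ℝ}
    (hR : ∀ᵐ x ∂μ, ‖h x‖ ≤ R) {f : V → H → ℝ} (hf : Continuous fun z : V × H => f z.1 z.2) :
    Continuous fun v => ∫ x, f v (h x) ∂μ := by
  have : ProperSpace H := FiniteDimensional.proper_real H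
  rw [continuous_iff_continuousAt]
  intro v
  obtain ⟨S, hS, hSv⟩ := exists_compact_mem_nhds v
  obtain ⟨K, hK⟩ := (hS.prod (isCompact_closedBall (0 : H) R)).exists_bound_of_continuousOn
    hf.continuousOn
  refine continuousAt_of_dominated (bound := fun _ => K) ?_ ?_ (integrable_const K) ?_
  · refine Eventually.of_forall fun w => ?_
    exact (hf.comp (by fun_prop : Continuous fun y : H => (w, y))).comp_aestronglyMeasurable hh
  · filter_upwards [hSv] with w hw
    filter_upwards [hR] with x hx
    exact hK (w, h x) ⟨hw, by simpa using hx⟩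
  · refine Eventually.of_forall fun x => ?_
    exact (hf.comp (by fun_prop : Continuous fun w : V => (w, h x))).continuousAt

end Parametric

/-! ### The truncation -/

theorem abs_truncHat_le {R eps : ℝ} (hR : 0 ≤ R) (heps : 0 ≤ eps) (d : ℕ) (y : ℝ) :
    |truncHat R eps d y| ≤ R / d := by
  have hRd : 0 ≤ R / (d : ℝ) := by positivity
  unfold truncHat
  split_ifs with h
  · rw [abs_mul, abs_of_nonneg hRd, abs_div, abs_abs]
    exact mul_le_of_le_one_right hRd (div_self_le_one _)
  · linarith

theorem measurable_truncHat (R eps : ℝ) (d : ℕ) : Measurable (truncHat R eps d) := by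
  unfold truncHat
  exact Measurable.ite (measurableSet_lt measurable_const measurable_id.abs)
    (measurable_const.mul (measurable_id.div measurable_id.abs)) measurable_id

section Trunc

variable {p : Params} (hR : 0 ≤ p.R) (heps : 0 ≤ p.eps) (hφ : IsMollifier p.φ p.eps) (d : ℕ)
include hφ

theorem IsMollifier.hasCompactSupport : HasCompactSupport p.φ := by
  refine HasCompactSupport.of_support_subset_isCompact (isCompact_Icc (a := -p.eps) (b := p.eps)) ?_
  intro y hy
  exact abs_le.1 (hφ.support y hy)

include hR heps

/-- The truncation is the convolution of a smooth compactly supported kernel with a bounded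
measurable function, and inherits the regularity of the kernel. -/
theorem contDiff_trunc : ContDiff ℝ 1 (trunc p d) := by
  have hloc : LocallyIntegrable (truncHat p.R p.eps d) volume := by
    rw [locallyIntegrable_iff]
    intro k hk
    exact Measure.integrableOn_of_bounded hk.measure_lt_top.ne
      (measurable_truncHat _ _ d).aestronglyMeasurable (M := p.R / d)
      (Eventually.of_forall fun y => abs_truncHat_le hR heps d y)
  have h := hφ.hasCompactSupport.contDiff_convolution_left (n := 1) (ContinuousLinearMap.mul ℝ ℝ)
    (hφ.smooth.of_le (by exact_mod_cast le_top)) hloc (μ := volume)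
  have heq : trunc p d = _ := funext fun q => (convolution_eq_swap
    (f := p.φ) (g := truncHat p.R p.eps d) (L := ContinuousLinearMap.mul ℝ ℝ) (x := q)).symm
  rw [heq]
  exact h

theorem abs_trunc_le (q : ℝ) : |trunc p d q| ≤ p.R / d := by
  have hint : Integrable p.φ := hφ.smooth.continuous.integrable_of_hasCompactSupport
    hφ.hasCompactSupport
  have hint' : Integrable (fun y => p.φ (q - y) * (p.R / d)) := (hint.comp_sub_left q).mul_const _
  calc |trunc p d q| ≤ ∫ y, p.φ (q - y) * (p.R / d) := by
        rw [← Real.norm_eq_abs]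
        refine norm_integral_le_of_norm_le hint' (Eventually.of_forall fun y => ?_)
        rw [Real.norm_eq_abs, abs_mul, abs_of_nonneg (hφ.nonneg _)]
        exact mul_le_mul_of_nonneg_left (abs_truncHat_le hR heps d y) (hφ.nonneg _)
    _ = p.R / d := by
        rw [integral_mul_const, integral_sub_left_eq_self p.φ volume q, hφ.integral, one_mul]

end Trunc

/-- The difference quotient of a `C¹` function is jointly continuous. -/
theorem continuous_dslope_uncurry {τ : ℝ → ℝ} (hτ : ContDiff ℝ 1 τ) :
    Continuous fun z : ℝ × ℝ => dslope τ z.2 z.1 := by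
  have hd : Continuous (deriv τ) := hτ.continuous_deriv le_rfl
  -- Averaging the derivative over the segment from `z.2` to `z.1` removes the case distinction on
  -- the diagonal and makes continuity there evident.
  have : (fun z : ℝ × ℝ => dslope τ z.2 z.1) =
      fun z => ∫ t in (0 : ℝ)..1, deriv τ (z.2 + t * (z.1 - z.2)) := by
    funext ⟨a, b⟩
    rcases eq_or_ne a b with rfl | hab
    · simp
    · have hne : a - b ≠ 0 := sub_ne_zero.2 hab
      rw [dslope_of_ne _ hab, slope_def_field]
      have h := intervalIntegral.integral_comp_add_mul (a := 0) (b := 1) (deriv τ) hne b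
      have h2 : ∫ x in b..a, deriv τ x = τ a - τ b :=
        intervalIntegral.integral_deriv_eq_sub
          (fun x _ => (hτ.differentiable one_ne_zero) x) (hd.intervalIntegrable _ _)
      simp only [mul_zero, add_zero, mul_one, add_sub_cancel, h2] at h
      simp only [mul_comm _ (a - b), h, smul_eq_mul]
      rw [div_eq_inv_mul]
  rw [this]
  exact intervalIntegral.continuous_parametric_intervalIntegral_of_continuous' (by fun_prop) 0 1

/-- The bound is uniform in `a`. For `|a| ≤ K + 1` it comes from compactness; beyond, `|a - b| > 1`,
the quotient is at most `2T / |a - b|`, and `|a| ≤ (K + 1) |a - b|`. This prevents the `ε₂` coupling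
from growing with the new tensor field. -/
theorem exists_bound_dslope_mul {τ : ℝ → ℝ} (hτ : ContDiff ℝ 1 τ) {T : ℝ} (hT : ∀ q, |τ q| ≤ T)
    (K : ℝ) : ∃ C, ∀ a b, |b| ≤ K → |dslope τ b a * a| ≤ C := by
  obtain ⟨C, hC⟩ := ((isCompact_Icc (a := -(K + 1)) (b := K + 1)).prod
    (isCompact_Icc (a := -K) (b := K))).exists_bound_of_continuousOn
      (f := fun z : ℝ × ℝ => dslope τ z.2 z.1 * z.1)
      ((continuous_dslope_uncurry hτ).mul continuous_fst).continuousOn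
  refine ⟨max C (2 * T * (K + 1)), fun a b hb => ?_⟩
  have hK : 0 ≤ K := (abs_nonneg b).trans hb
  by_cases ha : |a| ≤ K + 1
  · exact (hC (a, b) ⟨abs_le.1 ha, abs_le.1 hb⟩).trans (le_max_left _ _)
  · refine le_trans ?_ (le_max_right _ _)
    push Not at ha
    have h1 : |a| - |b| ≤ |a - b| := abs_sub_abs_le_abs_sub a b
    have hpos : 0 < |a - b| := by linarith
    have hne : a ≠ b := fun h => by simp [h] at hpos
    rw [dslope_of_ne _ hne, slope_def_field, abs_mul, abs_div, div_mul_eq_mul_div,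
      div_le_iff₀ hpos]
    have h2 : |τ a - τ b| ≤ 2 * T := by
      have := abs_sub (τ a) (τ b)
      linarith [hT a, hT b]
    have h3 : |a| ≤ (K + 1) * |a - b| := by nlinarith
    have hT0 : 0 ≤ T := (abs_nonneg _).trans (hT 0)
    calc |τ a - τ b| * |a| ≤ (2 * T) * ((K + 1) * |a - b|) := by gcongr
      _ = _ := by ring

theorem Ptilde_apply {d : ℕ} (p : Params) (Q' Q : Mat d) (i j : Fin d) :
    Ptilde p Q' Q i j = dslope (trunc p d) (Q i j) (Q' i j) := by
  simp only [Ptilde, truncM, Matrix.of_apply]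
  split_ifs with h
  · rw [dslope_of_ne _ (sub_ne_zero.1 h), slope_def_field]
  · rw [sub_eq_zero.1 (not_not.1 h), dslope_same]

/-! ### The finite element spaces -/

section Sobolev

variable {d : ℕ} {Ω : Set (Pt d)}

theorem IsTestFunction.continuous_pd {φ : Pt d → ℝ} (hφ : IsTestFunction Ω φ) (k : Fin d) :
    Continuous (pd k φ) :=
  (hφ.smooth.continuous_fderiv (by simp)).clm_apply continuous_const

theorem IsTestFunction.memLp {φ : Pt d → ℝ} (hφ : IsTestFunction Ω φ) :
    MemLp φ 2 (volume.restrict Ω) :=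
  (hφ.smooth.continuous.memLp_of_hasCompactSupport hφ.compact).restrict Ω

theorem IsTestFunction.memLp_pd {φ : Pt d → ℝ} (hφ : IsTestFunction Ω φ) (k : Fin d) :
    MemLp (pd k φ) 2 (volume.restrict Ω) :=
  ((hφ.continuous_pd k).memLp_of_hasCompactSupport (hφ.compact.fderiv_apply ℝ _)).restrict Ω

theorem pd_add {v w : Pt d → ℝ} {x : Pt d} (hv : DifferentiableAt ℝ v x)
    (hw : DifferentiableAt ℝ w x) (k : Fin d) :
    pd k (fun y => v y + w y) x = pd k v x + pd k w x := by
  simp [pd, fderiv_fun_add hv hw]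

theorem pd_const_mul {v : Pt d → ℝ} {x : Pt d} (hv : DifferentiableAt ℝ v x) (c : ℝ) (k : Fin d) :
    pd k (fun y => c * v y) x = c * pd k v x := by
  simp [pd, fderiv_const_mul hv]

theorem pd_sum {ι : Type*} {s : Finset ι} {v : ι → Pt d → ℝ} {x : Pt d}
    (hv : ∀ i ∈ s, DifferentiableAt ℝ (v i) x) (k : Fin d) :
    pd k (fun y => ∑ i ∈ s, v i y) x = ∑ i ∈ s, pd k (v i) x := by
  simp [pd, fderiv_fun_sum hv]

theorem IsTestFunction.add {φ ψ : Pt d → ℝ} (hφ : IsTestFunction Ω φ) (hψ : IsTestFunction Ω ψ) :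
    IsTestFunction Ω (fun x => φ x + ψ x) where
  smooth := hφ.smooth.add hψ.smooth
  compact := hφ.compact.add hψ.compact
  subset := (tsupport_add φ ψ).trans (Set.union_subset hφ.subset hψ.subset)

theorem IsTestFunction.const_mul {φ : Pt d → ℝ} (hφ : IsTestFunction Ω φ) (c : ℝ) :
    IsTestFunction Ω (fun x => c * φ x) where
  smooth := contDiff_const.mul hφ.smooth
  compact := hφ.compact.mul_left
  subset := (closure_mono (Function.support_mul_subset_right _ _)).trans hφ.subset

theorem IsTestFunction.differentiableAt {φ : Pt d → ℝ} (hφ : IsTestFunction Ω φ) (x : Pt d) :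
    DifferentiableAt ℝ φ x :=
  (hφ.smooth.differentiable (by simp)) x

theorem HasWeakPartial.add {k : Fin d} {v w v' w' : Pt d → ℝ} (h : HasWeakPartial Ω k v w)
    (h' : HasWeakPartial Ω k v' w') (hv : MemLp v 2 (volume.restrict Ω))
    (hv' : MemLp v' 2 (volume.restrict Ω)) (hw : MemLp w 2 (volume.restrict Ω))
    (hw' : MemLp w' 2 (volume.restrict Ω)) :
    HasWeakPartial Ω k (fun x => v x + v' x) (fun x => w x + w' x) := by
  intro φ hφ
  simp only [add_mul]
  have h1 := integral_add (hv.integrable_mul (hφ.memLp_pd k)) (hv'.integrable_mul (hφ.memLp_pd k))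
  have h2 := integral_add (hw.integrable_mul hφ.memLp) (hw'.integrable_mul hφ.memLp)
  simp only [Pi.mul_apply] at h1 h2
  rw [h1, h2, h φ hφ, h' φ hφ]
  ring

theorem HasWeakPartial.const_mul {k : Fin d} {v w : Pt d → ℝ} (h : HasWeakPartial Ω k v w)
    (c : ℝ) : HasWeakPartial Ω k (fun x => c * v x) (fun x => c * w x) := by
  intro φ hφ
  simp only [mul_assoc, integral_const_mul, h φ hφ]
  ring

theorem MemH1.add {v w : Pt d → ℝ} (hv : MemH1 Ω v) (hw : MemH1 Ω w) :
    MemH1 Ω (fun x => v x + w x) := by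
  refine ⟨hv.1.add hw.1, fun k => ?_⟩
  obtain ⟨a, ha, hva⟩ := hv.2 k
  obtain ⟨b, hb, hwb⟩ := hw.2 k
  exact ⟨_, ha.add hb, hva.add hwb hv.1 hw.1 ha hb⟩

theorem MemH1.const_mul {v : Pt d → ℝ} (hv : MemH1 Ω v) (c : ℝ) : MemH1 Ω (fun x => c * v x) := by
  refine ⟨hv.1.const_mul c, fun k => ?_⟩
  obtain ⟨a, ha, hva⟩ := hv.2 k
  exact ⟨_, ha.const_mul c, hva.const_mul c⟩

theorem tendsto_eLpNorm_add {μ : Measure (Pt d)} {f g : ℕ → Pt d → ℝ} {v w : Pt d → ℝ}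
    (hf : ∀ m, MemLp (f m) 2 μ) (hg : ∀ m, MemLp (g m) 2 μ) (hv : MemLp v 2 μ) (hw : MemLp w 2 μ)
    (h : Tendsto (fun m => eLpNorm (fun x => f m x - v x) 2 μ) atTop (𝓝 0))
    (h' : Tendsto (fun m => eLpNorm (fun x => g m x - w x) 2 μ) atTop (𝓝 0)) :
    Tendsto (fun m => eLpNorm (fun x => (f m x + g m x) - (v x + w x)) 2 μ) atTop (𝓝 0) := by
  refine tendsto_of_tendsto_of_tendsto_of_le_of_le tendsto_const_nhds
    (by simpa using h.add h') (fun m => zero_le) fun m => ?_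
  have : (fun x => (f m x + g m x) - (v x + w x)) =
      (fun x => f m x - v x) + fun x => g m x - w x := by
    funext x
    simp only [Pi.add_apply]
    ring
  simp only [this]
  exact eLpNorm_add_le ((hf m).sub hv).1 ((hg m).sub hw).1 one_le_two

theorem tendsto_eLpNorm_const_mul {μ : Measure (Pt d)} {f : ℕ → Pt d → ℝ} {v : Pt d → ℝ} (c : ℝ)
    (h : Tendsto (fun m => eLpNorm (fun x => f m x - v x) 2 μ) atTop (𝓝 0)) :
    Tendsto (fun m => eLpNorm (fun x => c * f m x - c * v x) 2 μ) atTop (𝓝 0) := by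
  have : ∀ m, eLpNorm (fun x => c * f m x - c * v x) 2 μ =
      ‖c‖ₑ * eLpNorm (fun x => f m x - v x) 2 μ := fun m => by
    rw [← eLpNorm_const_smul]
    congr 1
    funext x
    simp [mul_sub]
  simp only [this]
  simpa using ENNReal.Tendsto.const_mul h (Or.inr enorm_ne_top)

theorem MemH10.zero : MemH10 Ω (fun _ => (0 : ℝ)) := by
  have hw : ∀ k : Fin d, HasWeakPartial Ω k (fun _ => (0 : ℝ)) (fun _ => 0) := fun k φ _ => by simp
  refine ⟨⟨MemLp.zero, fun k => ⟨_, MemLp.zero, hw k⟩⟩, fun _ _ => 0, fun m => ⟨contDiff_const,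
    HasCompactSupport.zero, by simp [tsupport]⟩, by simp, fun k => ⟨_, MemLp.zero, hw k, ?_⟩⟩
  simp [pd]

theorem MemH10.add {v w : Pt d → ℝ} (hv : MemH10 Ω v) (hw : MemH10 Ω w) :
    MemH10 Ω (fun x => v x + w x) := by
  obtain ⟨hv1, φ, hφ, hφv, hφk⟩ := hv
  obtain ⟨hw1, ψ, hψ, hψw, hψk⟩ := hw
  refine ⟨hv1.add hw1, fun m x => φ m x + ψ m x, fun m => (hφ m).add (hψ m),
    tendsto_eLpNorm_add (fun m => (hφ m).memLp) (fun m => (hψ m).memLp) hv1.1 hw1.1 hφv hψw,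
    fun k => ?_⟩
  obtain ⟨a, ha, hva, hca⟩ := hφk k
  obtain ⟨b, hb, hwb, hcb⟩ := hψk k
  refine ⟨_, ha.add hb, hva.add hwb hv1.1 hw1.1 ha hb, ?_⟩
  have := tendsto_eLpNorm_add (fun m => (hφ m).memLp_pd k) (fun m => (hψ m).memLp_pd k)
    ha hb hca hcb
  refine this.congr fun m => ?_
  congr 1
  funext x
  rw [pd_add ((hφ m).differentiableAt x) ((hψ m).differentiableAt x)]
  rfl

theorem MemH10.const_mul {v : Pt d → ℝ} (hv : MemH10 Ω v) (c : ℝ) :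
    MemH10 Ω (fun x => c * v x) := by
  obtain ⟨hv1, φ, hφ, hφv, hφk⟩ := hv
  refine ⟨hv1.const_mul c, fun m x => c * φ m x, fun m => (hφ m).const_mul c,
    tendsto_eLpNorm_const_mul c hφv, fun k => ?_⟩
  obtain ⟨a, ha, hva, hca⟩ := hφk k
  refine ⟨_, ha.const_mul c, hva.const_mul c, ?_⟩
  refine (tendsto_eLpNorm_const_mul c hca).congr fun m => ?_
  congr 1
  funext x
  rw [pd_const_mul ((hφ m).differentiableAt x)]

end Sobolev

/-! ### Mesh geometry: derivatives in cells, bounds, and a finite spanning family. -/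

section Mesh

variable {d : ℕ} {Ω : Set (Pt d)} {𝒯 : Geometry.SimplicialComplex ℝ (Pt d)}

theorem IsPiecewiseP1.add {v w : Pt d → ℝ} (hv : IsPiecewiseP1 𝒯 v) (hw : IsPiecewiseP1 𝒯 w) :
    IsPiecewiseP1 𝒯 (fun x => v x + w x) := by
  intro s hs hc
  obtain ⟨p, hp⟩ := hv s hs hc
  obtain ⟨q, hq⟩ := hw s hs hc
  exact ⟨p + q, fun x hx => by simp [hp x hx, hq x hx]⟩

theorem IsPiecewiseP1.const_mul {v : Pt d → ℝ} (hv : IsPiecewiseP1 𝒯 v) (c : ℝ) :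
    IsPiecewiseP1 𝒯 (fun x => c * v x) := by
  intro s hs hc
  obtain ⟨p, hp⟩ := hv s hs hc
  exact ⟨c • p, fun x hx => by simp [hp x hx]⟩

variable (Ω 𝒯) in
/-- The space `Y_h` as a vector space. -/
def YhSubmodule : Submodule ℝ (Pt d → ℝ) where
  carrier := Yh Ω 𝒯
  add_mem' hv hw := ⟨hv.1.add hw.1, hv.2.add hw.2⟩
  zero_mem' := ⟨MemH10.zero, fun _ _ _ => ⟨0, fun _ _ => rfl⟩⟩
  smul_mem' c _ hv := ⟨hv.1.const_mul c, hv.2.const_mul c⟩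

theorem sum_mem_Yh {m : ℕ} {f : Fin m → Pt d → ℝ} (hf : ∀ a, f a ∈ Yh Ω 𝒯) (w : Fin m → ℝ) :
    (fun x => ∑ a, w a * f a x) ∈ Yh Ω 𝒯 := by
  have : (∑ a, w a • f a) ∈ YhSubmodule Ω 𝒯 :=
    Submodule.sum_mem _ fun a _ => Submodule.smul_mem _ _ (hf a)
  have heq : (fun x => ∑ a, w a * f a x) = ∑ a, w a • f a := by
    funext x
    simp
  rw [heq]
  exact this

variable (𝒯) in
/-- The union of the interiors of the `d`-dimensional simplices. -/
def cellInteriors : Set (Pt d) :=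
  ⋃ s ∈ {s ∈ 𝒯.faces | s.card = d + 1}, interior (convexHull ℝ (s : Set (Pt d)))

theorem IsTriangulation.exists_cell (h : IsTriangulation 𝒯 Ω) {x : Pt d} (hx : x ∈ closure Ω) :
    ∃ s ∈ 𝒯.faces, s.card = d + 1 ∧ x ∈ convexHull ℝ (s : Set (Pt d)) := by
  rw [← h.space_eq, Geometry.SimplicialComplex.mem_space_iff] at hx
  obtain ⟨s, hs, hxs⟩ := hx
  obtain ⟨t, ht, hst, hc⟩ := h.pure s hs
  exact ⟨t, ht, hc, convexHull_mono (by exact_mod_cast hst) hxs⟩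

/-- A point of `Ω` outside all cell interiors lies on the frontier of one of finitely many convex
sets, and such frontiers are null. Classical derivatives of piecewise linear functions therefore
exist almost everywhere. -/
theorem IsTriangulation.ae_mem_cellInteriors (h : IsTriangulation 𝒯 Ω) (hΩ : IsOpen Ω) :
    ∀ᵐ x ∂volume.restrict Ω, x ∈ cellInteriors 𝒯 := by
  rw [ae_restrict_iff' hΩ.measurableSet, ae_iff]
  refine measure_mono_null (t := ⋃ s ∈ 𝒯.faces, frontier (convexHull ℝ (s : Set (Pt d)))) ?_ ?_
  · intro x hx
    simp only [Set.mem_ofPred_eq, Classical.not_imp] at hx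
    obtain ⟨s, hs, hc, hxs⟩ := h.exists_cell (subset_closure hx.1)
    refine Set.mem_biUnion hs ⟨subset_closure hxs, fun hi => hx.2 ?_⟩
    exact Set.mem_biUnion (show s ∈ {s ∈ 𝒯.faces | s.card = d + 1} from ⟨hs, hc⟩) hi
  · rw [measure_biUnion_null_iff h.finite.countable]
    exact fun s _ => (convex_convexHull ℝ _).addHaar_frontier volume

theorem IsTriangulation.isCompact_closure (h : IsTriangulation 𝒯 Ω) : IsCompact (closure Ω) := by
  rw [← h.space_eq]
  exact h.finite.isCompact_biUnion fun s _ => s.finite_toSet.isCompact_convexHull (𝕜 := ℝ)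

theorem IsTriangulation.isFiniteMeasure (h : IsTriangulation 𝒯 Ω) :
    IsFiniteMeasure (volume.restrict Ω) :=
  isFiniteMeasure_restrict.2
    ((measure_mono subset_closure).trans_lt h.isCompact_closure.measure_lt_top).ne

theorem hasFDerivAt_affineMap (p : Pt d →ᵃ[ℝ] ℝ) (x : Pt d) :
    HasFDerivAt p p.linear.toContinuousLinearMap x := by
  have : (p : Pt d → ℝ) = fun y => p.linear.toContinuousLinearMap y + p 0 := by
    rw [AffineMap.decomp p]
    funext y
    simp
  rw [this]
  exact (ContinuousLinearMap.hasFDerivAt _).add_const _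

theorem IsPiecewiseP1.exists_hasFDerivAt {v : Pt d → ℝ} (hv : IsPiecewiseP1 𝒯 v)
    {s : Finset (Pt d)} (hs : s ∈ 𝒯.faces) (hc : s.card = d + 1) :
    ∃ l : Pt d →L[ℝ] ℝ, ∀ x ∈ interior (convexHull ℝ (s : Set (Pt d))), HasFDerivAt v l x := by
  obtain ⟨p, hp⟩ := hv s hs hc
  refine ⟨p.linear.toContinuousLinearMap, fun x hx => ?_⟩
  refine (hasFDerivAt_affineMap p x).congr_of_eventuallyEq ?_
  filter_upwards [isOpen_interior.mem_nhds hx] with y hy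
  exact hp y (interior_subset hy)

theorem IsPiecewiseP1.differentiableAt {v : Pt d → ℝ} (hv : IsPiecewiseP1 𝒯 v) {x : Pt d}
    (hx : x ∈ cellInteriors 𝒯) : DifferentiableAt ℝ v x := by
  obtain ⟨s, ⟨hs, hc⟩, hxs⟩ := Set.mem_iUnion₂.1 hx
  obtain ⟨l, hl⟩ := hv.exists_hasFDerivAt hs hc
  exact (hl x hxs).differentiableAt

theorem IsPiecewiseP1.exists_bound_pd {v : Pt d → ℝ} (hv : IsPiecewiseP1 𝒯 v)
    (h : IsTriangulation 𝒯 Ω) : ∃ K, ∀ x ∈ cellInteriors 𝒯, ∀ k, |pd k v x| ≤ K := by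
  choose! l hl using fun (s : Finset (Pt d)) (hs : s ∈ 𝒯.faces ∧ s.card = d + 1) =>
    hv.exists_hasFDerivAt hs.1 hs.2
  obtain ⟨K, hK⟩ := (h.finite.image fun s => ‖l s‖).bddAbove
  refine ⟨K, fun x hx k => ?_⟩
  obtain ⟨s, hs, hxs⟩ := Set.mem_iUnion₂.1 hx
  have h1 : pd k v x = l s (EuclideanSpace.single k 1) := by rw [pd, (hl s hs x hxs).fderiv]
  rw [h1, ← Real.norm_eq_abs]
  have h2 := (l s).le_opNorm (EuclideanSpace.single k 1)
  simp only [PiLp.norm_single, norm_one, mul_one] at h2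
  exact h2.trans (hK ⟨s, hs.1, rfl⟩)

theorem IsPiecewiseP1.exists_bound {v : Pt d → ℝ} (hv : IsPiecewiseP1 𝒯 v)
    (h : IsTriangulation 𝒯 Ω) : ∃ K, ∀ x ∈ closure Ω, |v x| ≤ K := by
  have hb : ∀ s ∈ {s ∈ 𝒯.faces | s.card = d + 1}, ∃ K, ∀ x ∈ convexHull ℝ (s : Set (Pt d)),
      |v x| ≤ K := by
    rintro s ⟨hs, hc⟩
    obtain ⟨p, hp⟩ := hv s hs hc
    obtain ⟨K, hK⟩ := s.finite_toSet.isCompact_convexHull (𝕜 := ℝ).exists_bound_of_continuousOn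
      (continuous_iff_continuousAt.2 fun x => (hasFDerivAt_affineMap p x).continuousAt).continuousOn
    exact ⟨K, fun x hx => by rw [hp x hx]; exact hK x hx⟩
  choose! K hK using hb
  obtain ⟨K₀, hK₀⟩ := (h.finite.image K).bddAbove
  refine ⟨K₀, fun x hx => ?_⟩
  obtain ⟨s, hs, hc, hxs⟩ := h.exists_cell hx
  exact (hK s ⟨hs, hc⟩ x hxs).trans (hK₀ ⟨s, hs, rfl⟩)

/-- A finite family in `Y_h` that spans `Y_h` on the closure of `Ω`. -/
theorem IsTriangulation.exists_family (h : IsTriangulation 𝒯 Ω) :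
    ∃ (m : ℕ) (f : Fin m → Pt d → ℝ), (∀ a, f a ∈ Yh Ω 𝒯) ∧
      ∀ v ∈ Yh Ω 𝒯, ∃ w : Fin m → ℝ, ∀ x ∈ closure Ω, v x = ∑ a, w a * f a x := by
  let S : Set (Pt d) := ⋃ s ∈ 𝒯.faces, (s : Set (Pt d))
  have hS : S.Finite := h.finite.biUnion fun s _ => s.finite_toSet
  have : Finite S := hS
  -- Restriction to the finitely many vertices. A piecewise linear function vanishing at the
  -- vertices vanishes on each cell, so lifting a basis of the range of `T` yields a family that
  -- spans on the closure.
  let T : YhSubmodule Ω 𝒯 →ₗ[ℝ] (S → ℝ) :=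
    (LinearMap.funLeft ℝ ℝ ((↑) : S → Pt d)) ∘ₗ (YhSubmodule Ω 𝒯).subtype
  let b := Module.finBasis ℝ (LinearMap.range T)
  choose g hg using fun a => (b a).2
  refine ⟨_, fun a => g a, fun a => (g a).2, fun v hv => ?_⟩
  let c := b.repr ⟨T ⟨v, hv⟩, LinearMap.mem_range_self T _⟩
  refine ⟨fun a => c a, fun x hx => ?_⟩
  let u : YhSubmodule Ω 𝒯 := ⟨v, hv⟩ - ∑ a, c a • g a
  have hu : T u = 0 := by
    have h1 := congrArg Subtype.val (b.sum_repr ⟨T ⟨v, hv⟩, LinearMap.mem_range_self T _⟩)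
    simp only [Submodule.coe_sum, Submodule.coe_smul, ← hg] at h1
    simp only [u, map_sub, map_sum, map_smul]
    rw [h1, sub_self]
  obtain ⟨s, hs, hc, hxs⟩ := h.exists_cell hx
  obtain ⟨p, hp⟩ := u.2.2 s hs hc
  have hps : ∀ y ∈ (s : Set (Pt d)), p y = 0 := fun y hy => by
    rw [← hp y (subset_convexHull ℝ _ hy)]
    exact congrFun hu ⟨y, Set.mem_biUnion hs hy⟩
  have hconv : convexHull ℝ (s : Set (Pt d)) ⊆ p ⁻¹' {0} :=
    convexHull_min hps ((convex_singleton (0 : ℝ)).affine_preimage p)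
  have hux : (u : Pt d → ℝ) x = 0 := by rw [hp x hxs]; exact hconv hxs
  have hu' : (u : Pt d → ℝ) x = v x - ∑ a, c a * (g a : Pt d → ℝ) x := by
    simp [u, Finset.sum_apply]
  linarith

end Mesh

/-! ### Pointwise algebra -/

theorem mul_le_young {θ : ℝ} (hθ : 0 < θ) (a b : ℝ) : a * b ≤ θ * (b * b) + a * a / (4 * θ) := by
  have h : 0 ≤ (2 * θ * b - a) ^ 2 / (4 * θ) := by positivity
  have : (2 * θ * b - a) ^ 2 / (4 * θ) = θ * (b * b) + a * a / (4 * θ) - a * b := by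
    field_simp
    ring
  linarith

theorem dotProduct_le_young {d : ℕ} {θ : ℝ} (hθ : 0 < θ) (a b : Fin d → ℝ) :
    a ⬝ᵥ b ≤ θ * (b ⬝ᵥ b) + a ⬝ᵥ a / (4 * θ) := by
  simp only [dotProduct, Finset.mul_sum, Finset.sum_div, ← Finset.sum_add_distrib]
  exact Finset.sum_le_sum fun i _ => mul_le_young hθ _ _

section Frob

variable {d : ℕ}

theorem frob_add_left (A B X : Mat d) : frob (A + B) X = frob A X + frob B X := by
  simp [frob, add_mul, Finset.sum_add_distrib]

theorem frob_add_right (X A B : Mat d) : frob X (A + B) = frob X A + frob X B := by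
  simp [frob, mul_add, Finset.sum_add_distrib]

theorem frob_smul_left (c : ℝ) (A X : Mat d) : frob (c • A) X = c * frob A X := by
  simp [frob, Finset.mul_sum, mul_assoc]

theorem frob_smul_right (c : ℝ) (X A : Mat d) : frob X (c • A) = c * frob X A := by
  simp [frob, Finset.mul_sum, mul_left_comm]

theorem frob_sub_left (A B X : Mat d) : frob (A - B) X = frob A X - frob B X := by
  simp [frob, sub_mul, Finset.sum_sub_distrib]

theorem frob_comm (A B : Mat d) : frob A B = frob B A := by
  simp [frob, mul_comm]

theorem frob_zero_right (X : Mat d) : frob X 0 = 0 := by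
  simp [frob]

theorem frob_one_left (A : Mat d) : frob 1 A = A.trace := by
  simp [frob, Matrix.trace, Matrix.one_apply]

theorem frob_transpose (A B : Mat d) : frob Aᵀ B = frob A Bᵀ := by
  simp only [frob, Matrix.transpose_apply]
  exact Finset.sum_comm

theorem frob_self_nonneg (A : Mat d) : 0 ≤ frob A A :=
  Finset.sum_nonneg fun _ _ => Finset.sum_nonneg fun _ _ => mul_self_nonneg _

theorem eq_zero_of_frob_self {A : Mat d} (h : frob A A = 0) : A = 0 := by
  ext i j
  have h1 := (Finset.sum_eq_zero_iff_of_nonneg fun i _ =>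
    Finset.sum_nonneg fun j _ => mul_self_nonneg (A i j)).1 h i (Finset.mem_univ i)
  have h2 := (Finset.sum_eq_zero_iff_of_nonneg fun j _ =>
    mul_self_nonneg (A i j)).1 h1 j (Finset.mem_univ j)
  simpa using h2

theorem sq_entry_le_frob (A : Mat d) (i j : Fin d) : A i j * A i j ≤ frob A A :=
  (Finset.single_le_sum (f := fun j => A i j * A i j) (fun _ _ => mul_self_nonneg _)
    (Finset.mem_univ j)).trans
    (Finset.single_le_sum (f := fun i => ∑ j, A i j * A i j)
      (fun _ _ => Finset.sum_nonneg fun _ _ => mul_self_nonneg _) (Finset.mem_univ i))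

theorem frob_le_young {θ : ℝ} (hθ : 0 < θ) (A B : Mat d) :
    frob A B ≤ θ * frob B B + frob A A / (4 * θ) := by
  simp only [frob, Finset.mul_sum, Finset.sum_div, ← Finset.sum_add_distrib]
  exact Finset.sum_le_sum fun i _ => Finset.sum_le_sum fun j _ => mul_le_young hθ _ _

theorem frob_mul_self_le (A B : Mat d) : frob (A * B) (A * B) ≤ frob A A * frob B B := by
  have hB : frob B B = ∑ j, ∑ k, B k j * B k j := Finset.sum_comm
  rw [hB]
  simp only [frob, Finset.sum_mul_sum]
  refine Finset.sum_le_sum fun i _ => Finset.sum_le_sum fun j _ => ?_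
  simp only [Matrix.mul_apply, ← Finset.sum_mul_sum, ← sq]
  exact Finset.sum_mul_sq_le_sq_mul_sq _ _ _

theorem trace_mul_self_of_isSymm {A : Mat d} (hA : A.IsSymm) : (A * A).trace = frob A A := by
  simp only [Matrix.trace, Matrix.diag_apply, Matrix.mul_apply, frob]
  refine Finset.sum_congr rfl fun i _ => Finset.sum_congr rfl fun j _ => ?_
  rw [hA.apply i j]

/-- Cauchy–Schwarz in each row costs a factor `d`, and so does summing the rows; the entry bound `R
/ d` compensates for both. -/
theorem mulVec_dotProduct_self_le {T : Mat d} {R : ℝ} (hT : ∀ i j, |T i j| ≤ R / d)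
    (v : Fin d → ℝ) : (T *ᵥ v) ⬝ᵥ (T *ᵥ v) ≤ R ^ 2 * (v ⬝ᵥ v) := by
  rcases Nat.eq_zero_or_pos d with rfl | hd
  · simp
  have hrow : ∀ i, (T *ᵥ v) i * (T *ᵥ v) i ≤ (d * (R / d) ^ 2) * (v ⬝ᵥ v) := by
    intro i
    have h1 := Finset.sum_mul_sq_le_sq_mul_sq Finset.univ (T i) v
    have h2 : ∑ j, T i j ^ 2 ≤ d * (R / d) ^ 2 := by
      have : ∀ j ∈ Finset.univ, T i j ^ 2 ≤ (R / d) ^ 2 := fun j _ => by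
        rw [← sq_abs]
        exact pow_le_pow_left₀ (abs_nonneg _) (hT i j) 2
      simpa using Finset.sum_le_sum this
    have h3 : (T *ᵥ v) i * (T *ᵥ v) i = (∑ j, T i j * v j) ^ 2 := by
      rw [sq]; rfl
    have h4 : v ⬝ᵥ v = ∑ j, v j ^ 2 := by simp [dotProduct, sq]
    rw [h3, h4]
    exact h1.trans (mul_le_mul_of_nonneg_right h2 (Finset.sum_nonneg fun _ _ => sq_nonneg _))
  have h := Finset.sum_le_sum fun i (_ : i ∈ Finset.univ) => hrow i
  simp only [Finset.sum_const, Finset.card_univ, Fintype.card_fin, nsmul_eq_mul] at h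
  refine h.trans (le_of_eq ?_)
  have : (d : ℝ) ≠ 0 := by positivity
  field_simp

theorem abs_mulVec_dotProduct_self_le {T : Mat d} {R : ℝ} (hR : 0 < R)
    (hT : ∀ i j, |T i j| ≤ R / d) (v : Fin d → ℝ) : |(T *ᵥ v) ⬝ᵥ v| ≤ R * (v ⬝ᵥ v) := by
  have h0 := mulVec_dotProduct_self_le hT v
  -- The weight `R / 2` balances the two terms: each is then at most `R / 2 * (v ⬝ᵥ v)`.
  have h1 := dotProduct_le_young (half_pos hR) (T *ᵥ v) v
  have h2 := dotProduct_le_young (half_pos hR) (-(T *ᵥ v)) v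
  rw [neg_dotProduct, neg_dotProduct, dotProduct_neg, neg_neg] at h2
  have h3 : (T *ᵥ v) ⬝ᵥ (T *ᵥ v) / (4 * (R / 2)) ≤ R / 2 * (v ⬝ᵥ v) := by
    rw [div_le_iff₀ (by positivity)]
    nlinarith
  exact abs_le.2 ⟨by linarith, by linarith⟩

/-- The projection of a matrix to the symmetric trace-free matrices. -/
def tfSym : Mat d →ₗ[ℝ] Mat d where
  toFun A := symPart A - ((1 / d : ℝ) * A.trace) • (1 : Mat d)
  map_add' A B := by
    simp only [symPart, Matrix.transpose_add, Matrix.trace_add]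
    module
  map_smul' c A := by
    simp only [symPart, Matrix.transpose_smul, Matrix.trace_smul, RingHom.id_apply, smul_eq_mul]
    module

theorem tfSym_apply (A : Mat d) : tfSym A = symPart A - ((1 / d : ℝ) * A.trace) • (1 : Mat d) := rfl

theorem tfSym_isSymm (A : Mat d) : (tfSym A).IsSymm := by
  rw [Matrix.IsSymm, tfSym_apply, symPart]
  simp [Matrix.transpose_sub, Matrix.transpose_smul, add_comm]

theorem trace_symPart (A : Mat d) : (symPart A).trace = A.trace := by
  simp only [symPart, Matrix.trace_smul, Matrix.trace_add, Matrix.trace_transpose, smul_eq_mul]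
  ring

theorem trace_tfSym (hd : d ≠ 0) (A : Mat d) : (tfSym A).trace = 0 := by
  have : (d : ℝ) ≠ 0 := by exact_mod_cast hd
  simp only [tfSym_apply, Matrix.trace_sub, trace_symPart, Matrix.trace_smul, Matrix.trace_one,
    smul_eq_mul, Fintype.card_fin]
  field_simp
  ring

theorem tfSym_eq_self {A : Mat d} (hA : A.IsSymm) (htr : A.trace = 0) : tfSym A = A := by
  rw [tfSym_apply, symPart, hA.eq, htr]
  module

/-- Self-adjointness moves the projection between force and test field, so arbitrary test fields may
be replaced by symmetric trace-free ones. -/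
theorem frob_tfSym_left (A B : Mat d) : frob (tfSym A) B = frob A (tfSym B) := by
  rw [frob_comm A]
  simp only [tfSym_apply, symPart, frob_sub_left, frob_smul_left, frob_add_left, frob_one_left,
    frob_transpose]
  rw [frob_comm B A, frob_comm B Aᵀ, frob_transpose]
  ring

theorem tfSym_dF1 {A : Mat d} (hd : d ≠ 0) (p : Params) (hA : A.IsSymm) (htr : A.trace = 0) :
    tfSym (dF1 p A) = dF1 p A := by
  have h1 : (d : ℝ) ≠ 0 := by exact_mod_cast hd
  apply tfSym_eq_self
  · rw [Matrix.IsSymm, dF1]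
    simp [Matrix.transpose_add, Matrix.transpose_sub, Matrix.transpose_smul, hA.eq]
  · simp only [dF1, Matrix.trace_add, Matrix.trace_sub, Matrix.trace_smul, Matrix.trace_one, htr,
      smul_eq_mul, Fintype.card_fin]
    field_simp
    ring

theorem tfSym_dF2 {A : Mat d} (p : Params) (hA : A.IsSymm) (htr : A.trace = 0) :
    tfSym (dF2 p A) = dF2 p A := by
  simp only [dF2, map_add, map_smul, tfSym_eq_self hA htr]

/-- The convex part of the bulk force is monotone at the origin. -/
theorem frob_dF1_self_nonneg {A : Mat d} {p : Params} (h₁ : |p.b| ≤ p.β₁) (h₂ : |p.b| ≤ p.β₂)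
    (hA : A.IsSymm) (htr : A.trace = 0) : 0 ≤ frob (dF1 p A) A := by
  have hq := frob_self_nonneg A
  have h1 := frob_le_young (θ := 1 / 2) (by norm_num) (A * A) A
  have h2 := frob_le_young (θ := 1 / 2) (by norm_num) (-(A * A)) A
  have h3 := frob_mul_self_le A A
  have hn : ∀ X Y : Mat d, frob (-X) Y = -frob X Y := fun X Y => by
    rw [← neg_one_smul ℝ X, frob_smul_left, neg_one_mul]
  rw [hn, frob_comm (-(A * A)) (-(A * A)), hn, frob_comm _ (-(A * A)), hn, neg_neg] at h2
  -- The cubic term is at most the mean of the quadratic and the quartic one. With the factor `|b|`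
  -- these are absorbed by `β₁` and `β₂` respectively.
  have habs : |frob (A * A) A| ≤ (frob A A + frob A A * frob A A) / 2 :=
    abs_le.2 ⟨by linarith, by linarith⟩
  have hb : p.b * frob (A * A) A ≤ |p.b| * ((frob A A + frob A A * frob A A) / 2) := by
    refine (le_abs_self _).trans ?_
    rw [abs_mul]
    gcongr
  have hval : frob (dF1 p A) A = p.β₁ * frob A A - p.b * frob (A * A) A
      + p.β₂ * (frob A A * frob A A) := by
    simp only [dF1, frob_add_left, frob_sub_left, frob_smul_left, frob_one_left, htr,
      trace_mul_self_of_isSymm hA]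
    ring
  rw [hval]
  have hq2 : 0 ≤ frob A A * frob A A := mul_nonneg hq hq
  nlinarith [mul_le_mul_of_nonneg_right h₁ hq, mul_le_mul_of_nonneg_right h₂ hq2,
    mul_nonneg (abs_nonneg p.b) hq, mul_nonneg (abs_nonneg p.b) hq2]

/-- The divergence of a matrix field with partial derivatives `D k`. -/
def divA (D : Fin d → Mat d) : Fin d → ℝ := fun i => ∑ j, D j i j

theorem divA_add (D D' : Fin d → Mat d) : divA (D + D') = divA D + divA D' := by
  funext i
  simp [divA, Finset.sum_add_distrib]

theorem divA_smul (c : ℝ) (D : Fin d → Mat d) : divA (c • D) = c • divA D := by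
  funext i
  simp [divA, Finset.mul_sum]

theorem divA_dotProduct_self_le (D : Fin d → Mat d) :
    divA D ⬝ᵥ divA D ≤ d * ∑ k, frob (D k) (D k) := by
  have h : ∀ i, divA D i * divA D i ≤ d * ∑ j, D j i j * D j i j := fun i => by
    have := sq_sum_le_card_mul_sum_sq (s := Finset.univ) (f := fun j => D j i j)
    simpa [divA, sq] using this
  have h2 : ∑ i, ∑ j, D j i j * D j i j ≤ ∑ k, frob (D k) (D k) := by
    rw [Finset.sum_comm]
    refine Finset.sum_le_sum fun k _ => Finset.sum_le_sum fun i _ => ?_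
    exact Finset.single_le_sum (f := fun j => D k i j * D k i j) (fun _ _ => mul_self_nonneg _)
      (Finset.mem_univ k)
  calc divA D ⬝ᵥ divA D ≤ ∑ i, (d : ℝ) * ∑ j, D j i j * D j i j :=
        Finset.sum_le_sum fun i _ => h i
    _ = d * ∑ i, ∑ j, D j i j * D j i j := by rw [Finset.mul_sum]
    _ ≤ _ := by gcongr

/-- The integrand of the weak form of one time step, tested with a symmetric trace-free field.
The old data are `q₀`, `D₀` (field and derivatives) and `U` (gradient of the potential), `γ` is the
gradient of the new boundary data, `q`, `D`, `y` are the new field, its derivatives and the gradient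
of the new interior potential, and `ξ`, `Ξ`, `η` are the corresponding test quantities. -/
def stepForm (p : Params) (q₀ : Mat d) (D₀ : Fin d → Mat d) (U γ : Fin d → ℝ)
    (q : Mat d) (D : Fin d → Mat d) (y : Fin d → ℝ)
    (ξ : Mat d) (Ξ : Fin d → Mat d) (η : Fin d → ℝ) : ℝ :=
  1 / p.dt * frob (q - q₀) ξ + p.M * p.L / 2 * ∑ k, frob (D₀ k + D k) (Ξ k)
    + p.M * frob (dF1 p q - dF2 p q₀) ξ
    - p.M * p.ε₂ / 2 * frob (Ptilde p q q₀ ⊙ vecMulVec U (y + γ)) ξ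
    - p.M * p.ε₃ / 2 * ((U + (y + γ)) ⬝ᵥ divA Ξ)
    + p.M / 2 * ((p.ε₁ • (y + γ) + p.ε₂ • (truncM p q *ᵥ (y + γ)) + p.ε₃ • divA D) ⬝ᵥ η)

theorem stepForm_add (p : Params) (q₀ : Mat d) (D₀ : Fin d → Mat d) (U γ : Fin d → ℝ)
    (q : Mat d) (D : Fin d → Mat d) (y : Fin d → ℝ)
    (ξ ξ' : Mat d) (Ξ Ξ' : Fin d → Mat d) (η η' : Fin d → ℝ) :
    stepForm p q₀ D₀ U γ q D y (ξ + ξ') (Ξ + Ξ') (η + η') =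
      stepForm p q₀ D₀ U γ q D y ξ Ξ η + stepForm p q₀ D₀ U γ q D y ξ' Ξ' η' := by
  simp only [stepForm, frob_add_right, Pi.add_apply, Finset.sum_add_distrib, divA_add,
    dotProduct_add]
  ring

theorem stepForm_smul (p : Params) (q₀ : Mat d) (D₀ : Fin d → Mat d) (U γ : Fin d → ℝ)
    (q : Mat d) (D : Fin d → Mat d) (y : Fin d → ℝ) (c : ℝ)
    (ξ : Mat d) (Ξ : Fin d → Mat d) (η : Fin d → ℝ) :
    stepForm p q₀ D₀ U γ q D y (c • ξ) (c • Ξ) (c • η) =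
      c * stepForm p q₀ D₀ U γ q D y ξ Ξ η := by
  simp only [stepForm, frob_smul_right, Pi.smul_apply, ← Finset.mul_sum, divA_smul,
    dotProduct_smul, smul_eq_mul]
  ring

theorem stepForm_zero (p : Params) (q₀ : Mat d) (D₀ : Fin d → Mat d) (U γ : Fin d → ℝ)
    (q : Mat d) (D : Fin d → Mat d) (y : Fin d → ℝ) :
    stepForm p q₀ D₀ U γ q D y 0 0 0 = 0 := by
  simpa using stepForm_smul p q₀ D₀ U γ q D y 0 0 0 0

theorem frob_hadamard_vecMulVec (P : Mat d) (U z : Fin d → ℝ) (ξ : Mat d) :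
    frob (P ⊙ vecMulVec U z) ξ = (fun j => ∑ i, U i * (P i j * ξ i j)) ⬝ᵥ z := by
  simp only [frob, Matrix.hadamard_apply, vecMulVec_apply, dotProduct, Finset.sum_mul]
  rw [Finset.sum_comm]
  refine Finset.sum_congr rfl fun j _ => Finset.sum_congr rfl fun i _ => ?_
  ring

/-- Attaching `ξ` to `P` before applying Young leaves only the products `P i j * ξ i j`. The bound
hence requires no separate control of `P` or `ξ`. -/
theorem abs_frob_hadamard_le {P ξ : Mat d} {C : ℝ} (hP : ∀ i j, |P i j * ξ i j| ≤ C)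
    {θ : ℝ} (hθ : 0 < θ) (U z : Fin d → ℝ) (s : ℝ) :
    s * frob (P ⊙ vecMulVec U z) ξ ≤
      θ * (z ⬝ᵥ z) + s ^ 2 * (d * ((U ⬝ᵥ U) * (d * C ^ 2))) / (4 * θ) := by
  rw [frob_hadamard_vecMulVec, ← smul_eq_mul, ← smul_dotProduct]
  refine (dotProduct_le_young hθ _ _).trans ?_
  gcongr
  rw [smul_dotProduct, dotProduct_smul, smul_eq_mul, smul_eq_mul, ← mul_assoc, ← sq]
  gcongr
  have h : ∀ j ∈ (Finset.univ : Finset (Fin d)), (∑ i, U i * (P i j * ξ i j)) *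
      (∑ i, U i * (P i j * ξ i j)) ≤ (U ⬝ᵥ U) * (d * C ^ 2) := by
    intro j _
    rw [← sq]
    refine (Finset.sum_mul_sq_le_sq_mul_sq _ _ _).trans ?_
    have h1 : ∑ i, U i ^ 2 = U ⬝ᵥ U := by simp [dotProduct, sq]
    have h2 : ∑ i, (P i j * ξ i j) ^ 2 ≤ d * C ^ 2 := by
      have : ∀ i ∈ (Finset.univ : Finset (Fin d)), (P i j * ξ i j) ^ 2 ≤ C ^ 2 := fun i _ => by
        rw [← sq_abs]
        exact pow_le_pow_left₀ (abs_nonneg _) (hP i j) 2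
      simpa using Finset.sum_le_sum this
    rw [h1]
    exact mul_le_mul_of_nonneg_left h2 (Finset.sum_nonneg fun _ _ => mul_self_nonneg _)
  simpa [dotProduct] using Finset.sum_le_sum h

end Frob

/-! ### Term-by-term lower bounds and coercivity of one time step. -/

section Coercive

variable {d : ℕ}

theorem neg_dotProduct_le_young {θ : ℝ} (hθ : 0 < θ) (a b : Fin d → ℝ) :
    -(a ⬝ᵥ b) ≤ θ * (b ⬝ᵥ b) + a ⬝ᵥ a / (4 * θ) := by
  have := dotProduct_le_young hθ (-a) b
  rwa [neg_dotProduct, neg_dotProduct, dotProduct_neg, neg_neg] at this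

theorem neg_frob_le_young {θ : ℝ} (hθ : 0 < θ) (A B : Mat d) :
    -frob A B ≤ θ * frob B B + frob A A / (4 * θ) := by
  have h := frob_le_young hθ ((-1 : ℝ) • A) B
  rwa [frob_smul_left, frob_smul_left, frob_smul_right, neg_one_mul, neg_one_mul, neg_one_mul,
    neg_neg] at h

theorem add_dotProduct_self_le (a b : Fin d → ℝ) :
    (a + b) ⬝ᵥ (a + b) ≤ 2 * (a ⬝ᵥ a) + 2 * (b ⬝ᵥ b) := by
  simp only [dotProduct, Finset.mul_sum, ← Finset.sum_add_distrib, Pi.add_apply]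
  exact Finset.sum_le_sum fun i _ => by nlinarith [sq_nonneg (a i - b i)]

theorem dotProduct_self_nonneg' (a : Fin d → ℝ) : 0 ≤ a ⬝ᵥ a :=
  Finset.sum_nonneg fun _ _ => mul_self_nonneg _

theorem young_time {q₀ q : Mat d} {δ K : ℝ} (hδ : 0 ≤ δ) (hq₀ : frob q₀ q₀ ≤ K) :
    δ * (3 / 4 * frob q q - K) ≤ δ * frob (q - q₀) q := by
  have h := frob_le_young (θ := 1 / 4) (by norm_num) q₀ q
  rw [frob_sub_left]
  refine mul_le_mul_of_nonneg_left ?_ hδ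
  linarith

theorem young_elastic {D₀ D : Fin d → Mat d} {δ K : ℝ} (hδ : 0 ≤ δ)
    (hD₀ : ∑ k, frob (D₀ k) (D₀ k) ≤ K) :
    δ * (3 / 4 * (∑ k, frob (D k) (D k)) - K) ≤ δ * ∑ k, frob (D₀ k + D k) (D k) := by
  have h := Finset.sum_le_sum fun k (_ : k ∈ Finset.univ) =>
    neg_frob_le_young (θ := 1 / 4) (by norm_num) (D₀ k) (D k)
  simp only [Finset.sum_neg_distrib, Finset.sum_add_distrib, ← Finset.mul_sum,
    ← Finset.sum_div] at h
  simp only [frob_add_left, Finset.sum_add_distrib]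
  refine mul_le_mul_of_nonneg_left ?_ hδ
  linarith

theorem young_bulk {p : Params} {q₀ q : Mat d} {θ K : ℝ} (hβ₁ : |p.b| ≤ p.β₁) (hβ₂ : |p.b| ≤ p.β₂)
    (hM : 0 ≤ p.M) (hθ : 0 < θ) (hF₂ : frob (dF2 p q₀) (dF2 p q₀) ≤ K) (hsymm : q.IsSymm)
    (htr : q.trace = 0) :
    -(p.M * θ * frob q q + p.M * (K / (4 * θ))) ≤ p.M * frob (dF1 p q - dF2 p q₀) q := by
  have h1 := frob_dF1_self_nonneg hβ₁ hβ₂ hsymm htr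
  have h2 := frob_le_young hθ (dF2 p q₀) q
  have h3 : frob (dF2 p q₀) (dF2 p q₀) / (4 * θ) ≤ K / (4 * θ) := by gcongr
  have h4 : -(θ * frob q q + K / (4 * θ)) ≤ frob (dF1 p q - dF2 p q₀) q := by
    rw [frob_sub_left]
    linarith
  have h5 := mul_le_mul_of_nonneg_left h4 hM
  linarith

/-- The right-hand side contains no norm of `q`: the `ε₂` coupling only has to be absorbed by the
electrostatic energy. -/
theorem young_truncation {P q : Mat d} {U γ y : Fin d → ℝ} {θ K C₀ : ℝ} (hθ : 0 < θ)
    (hP : ∀ i j, |P i j * q i j| ≤ C₀) (hU : U ⬝ᵥ U ≤ K) (hγ : γ ⬝ᵥ γ ≤ K) (s : ℝ) :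
    s * frob (P ⊙ vecMulVec U (y + γ)) q ≤
      2 * θ * (y ⬝ᵥ y) + (2 * θ * K + s ^ 2 * (d * (K * (d * C₀ ^ 2))) / (4 * θ)) := by
  have h := abs_frob_hadamard_le hP hθ U (y + γ) s
  have h2 := add_dotProduct_self_le y γ
  have h3 : s ^ 2 * (d * ((U ⬝ᵥ U) * (d * C₀ ^ 2))) / (4 * θ) ≤
      s ^ 2 * (d * (K * (d * C₀ ^ 2))) / (4 * θ) := by gcongr
  have h4 : θ * ((y + γ) ⬝ᵥ (y + γ)) ≤ θ * (2 * (y ⬝ᵥ y) + 2 * K) :=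
    mul_le_mul_of_nonneg_left (by linarith) hθ.le
  linarith

/-- Only data are paired with the divergence, so an arbitrarily small share of the elastic energy
suffices. -/
theorem young_divergence {D : Fin d → Mat d} {U γ : Fin d → ℝ} {θ K : ℝ} (hθ : 0 < θ)
    (hU : U ⬝ᵥ U ≤ K) (hγ : γ ⬝ᵥ γ ≤ K) (r : ℝ) :
    r * ((U + γ) ⬝ᵥ divA D) ≤
      θ * d * (∑ k, frob (D k) (D k)) + r ^ 2 * (4 * K) / (4 * θ) := by
  have h := dotProduct_le_young hθ (r • (U + γ)) (divA D)
  rw [smul_dotProduct, smul_dotProduct, dotProduct_smul, smul_eq_mul, smul_eq_mul, smul_eq_mul,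
    ← mul_assoc r r, ← sq] at h
  have h1 := add_dotProduct_self_le U γ
  have h2 := mul_le_mul_of_nonneg_left (divA_dotProduct_self_le D) hθ.le
  have h3 : r ^ 2 * ((U + γ) ⬝ᵥ (U + γ)) / (4 * θ) ≤ r ^ 2 * (4 * K) / (4 * θ) := by
    gcongr
    linarith
  linarith

/-- The truncated part of the dielectric matrix removes at most `|ε₂| R` from `ε₁`, leaving `a`. The
two terms with the boundary gradient `γ` use `a / 8` each, whence the factor `3 / 4`. -/
theorem young_electrostatic {T : Mat d} {γ y : Fin d → ℝ} {R K a ε₁ ε₂ : ℝ} (hR : 0 < R)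
    (ha : 0 < a) (hε : a = ε₁ - |ε₂| * R) (hT : ∀ i j, |T i j| ≤ R / d) (hγ : γ ⬝ᵥ γ ≤ K) :
    3 / 4 * a * (y ⬝ᵥ y) -
      (ε₁ ^ 2 * K / (4 * (a / 8)) + ε₂ ^ 2 * (R ^ 2 * K) / (4 * (a / 8))) ≤
      ε₁ * (y ⬝ᵥ y) + ε₁ * (γ ⬝ᵥ y) + (ε₂ * ((T *ᵥ y) ⬝ᵥ y) + ε₂ * ((T *ᵥ γ) ⬝ᵥ y)) := by
  have ha8 : 0 < a / 8 := by positivity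
  have h1 := neg_dotProduct_le_young ha8 (ε₁ • γ) y
  have h2 := neg_dotProduct_le_young ha8 (ε₂ • (T *ᵥ γ)) y
  simp only [smul_dotProduct, dotProduct_smul, smul_eq_mul] at h1 h2
  have h3 : ε₁ * (ε₁ * (γ ⬝ᵥ γ)) / (4 * (a / 8)) ≤ ε₁ ^ 2 * K / (4 * (a / 8)) := by
    rw [← mul_assoc, ← sq]
    gcongr
  have h4 : ε₂ * (ε₂ * ((T *ᵥ γ) ⬝ᵥ (T *ᵥ γ))) / (4 * (a / 8)) ≤
      ε₂ ^ 2 * (R ^ 2 * K) / (4 * (a / 8)) := by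
    rw [← mul_assoc, ← sq]
    gcongr
    exact (mulVec_dotProduct_self_le hT γ).trans (by gcongr)
  have h5 : -(|ε₂| * (R * (y ⬝ᵥ y))) ≤ ε₂ * ((T *ᵥ y) ⬝ᵥ y) := by
    refine le_trans ?_ (neg_abs_le _)
    rw [abs_mul]
    gcongr
    exact abs_mulVec_dotProduct_self_le hR hT y
  have h6 : ε₁ * (y ⬝ᵥ y) = a * (y ⬝ᵥ y) + |ε₂| * (R * (y ⬝ᵥ y)) := by
    rw [hε]
    ring
  linarith

/-- The evolution equation contains the mean of the two potentials, hence a factor `1/2` on the new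
one. Weighting the elliptic equation by `M / 2` makes `y ⬝ᵥ divA D` occur twice with opposite signs;
only its data counterpart `(U + γ) ⬝ᵥ divA D` survives. -/
theorem stepForm_self (p : Params) (q₀ : Mat d) (D₀ : Fin d → Mat d) (U γ : Fin d → ℝ)
    (q : Mat d) (D : Fin d → Mat d) (y : Fin d → ℝ) :
    stepForm p q₀ D₀ U γ q D y q D y =
      1 / p.dt * frob (q - q₀) q + p.M * p.L / 2 * ∑ k, frob (D₀ k + D k) (D k)
      + p.M * frob (dF1 p q - dF2 p q₀) q
      - p.M * p.ε₂ / 2 * frob (Ptilde p q q₀ ⊙ vecMulVec U (y + γ)) q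
      - p.M * p.ε₃ / 2 * ((U + γ) ⬝ᵥ divA D)
      + p.M / 2 * (p.ε₁ * (y ⬝ᵥ y) + p.ε₁ * (γ ⬝ᵥ y) +
        (p.ε₂ * ((truncM p q *ᵥ y) ⬝ᵥ y) + p.ε₂ * ((truncM p q *ᵥ γ) ⬝ᵥ y))) := by
  simp only [stepForm, add_dotProduct, smul_dotProduct, Matrix.mulVec_add, smul_add,
    smul_eq_mul, dotProduct_comm (divA D) y]
  ring

/-- Coercivity of one time step. The coupling terms with `ε₃` cancel up to the contribution of the
data, and the coupling with `ε₂` is controlled because the truncation is bounded. -/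
theorem exists_stepForm_coercive {p : Params} (hd : d ≠ 0) (hL : 0 < p.L) (hM : 0 < p.M)
    (hR : 0 < p.R) (hdt : 0 < p.dt) (heps : 0 < p.eps) (hφ : IsMollifier p.φ p.eps)
    (hβ₁ : |p.b| ≤ p.β₁) (hβ₂ : |p.b| ≤ p.β₂) (hε : |p.ε₂| * p.R < p.ε₁) (K : ℝ) :
    ∃ κ C : ℝ, 0 < κ ∧ ∀ (q₀ : Mat d) (D₀ : Fin d → Mat d) (U γ : Fin d → ℝ) (q : Mat d)
      (D : Fin d → Mat d) (y : Fin d → ℝ), frob q₀ q₀ ≤ K → ∑ k, frob (D₀ k) (D₀ k) ≤ K →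
      frob (dF2 p q₀) (dF2 p q₀) ≤ K → U ⬝ᵥ U ≤ K → γ ⬝ᵥ γ ≤ K → q.IsSymm → q.trace = 0 →
      κ * (frob q q + ∑ k, frob (D k) (D k) + y ⬝ᵥ y) - C ≤ stepForm p q₀ D₀ U γ q D y q D y := by
  -- The entries of `q₀` satisfy `|q₀ i j| ≤ 1 + K`, because their squares are at most `K` and `|t|
  -- ≤ 1 + t²`.
  obtain ⟨C₀, hC₀⟩ := exists_bound_dslope_mul (contDiff_trunc hR.le heps.le hφ d)
    (abs_trunc_le hR.le heps.le hφ d) (1 + K)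
  have hd0 : (0 : ℝ) < d := by exact_mod_cast Nat.pos_of_ne_zero hd
  obtain ⟨a, ha⟩ : ∃ a, a = p.ε₁ - |p.ε₂| * p.R := ⟨_, rfl⟩
  have hapos : 0 < a := by linarith
  obtain ⟨δ, hδ⟩ : ∃ δ, δ = 1 / p.dt := ⟨_, rfl⟩
  have hδ0 : 0 < δ := by rw [hδ]; positivity
  -- The Young parameters share out the available energy. The bulk data use `δ / 4` of `3 δ / 4`,
  -- the divergence `M L / 16` of `3 M L / 8`, and the truncation coupling `M a / 8` of `3 M a / 8`.
  -- At least `δ / 4`, `M L / 4` and `M a / 4` remain, which determine `κ`.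
  obtain ⟨θ₃, hθ₃⟩ : ∃ θ, θ = δ / (4 * p.M) := ⟨_, rfl⟩
  have hθ₃0 : 0 < θ₃ := by rw [hθ₃]; positivity
  obtain ⟨θ₅, hθ₅⟩ : ∃ θ, θ = p.M * p.L / (16 * d) := ⟨_, rfl⟩
  have hθ₅0 : 0 < θ₅ := by rw [hθ₅]; positivity
  have hθ₄0 : 0 < p.M * a / 16 := by positivity
  have e3 : p.M * θ₃ = δ / 4 := by rw [hθ₃]; field_simp
  have e5 : θ₅ * d = p.M * p.L / 16 := by rw [hθ₅]; field_simp
  obtain ⟨κ, hκ⟩ : ∃ κ, κ = min (δ / 4) (min (p.M * p.L / 4) (p.M * a / 4)) := ⟨_, rfl⟩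
  have hκ1 : κ ≤ δ / 4 := hκ ▸ min_le_left _ _
  have hκ2 : κ ≤ p.M * p.L / 4 := hκ ▸ (min_le_right _ _).trans (min_le_left _ _)
  have hκ3 : κ ≤ p.M * a / 4 := hκ ▸ (min_le_right _ _).trans (min_le_right _ _)
  refine ⟨κ, δ * K + p.M * p.L / 2 * K + p.M * (K / (4 * θ₃)) +
        (2 * (p.M * a / 16) * K +
          (p.M * p.ε₂ / 2) ^ 2 * (d * (K * (d * C₀ ^ 2))) / (4 * (p.M * a / 16))) +
        (p.M * p.ε₃ / 2) ^ 2 * (4 * K) / (4 * θ₅) +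
        p.M / 2 * (p.ε₁ ^ 2 * K / (4 * (a / 8)) + p.ε₂ ^ 2 * (p.R ^ 2 * K) / (4 * (a / 8))),
    by rw [hκ]; positivity,
    fun q₀ D₀ U γ q D y hq₀ hD₀ hF₂ hU hγ hsymm htr => ?_⟩
  rw [stepForm_self, ← hδ]
  have hP : ∀ i j, |Ptilde p q q₀ i j * q i j| ≤ C₀ := fun i j => by
    rw [Ptilde_apply]
    refine hC₀ _ _ ?_
    have := (sq_entry_le_frob q₀ i j).trans hq₀
    rw [← abs_mul_abs_self] at this
    nlinarith [sq_nonneg (|q₀ i j| - 1), abs_nonneg (q₀ i j)]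
  have t1 := young_time (q := q) hδ0.le hq₀
  have t2 := young_elastic (D := D) (δ := p.M * p.L / 2) (by positivity) hD₀
  have t3 := young_bulk hβ₁ hβ₂ hM.le hθ₃0 hF₂ hsymm htr
  have t4 := young_truncation (y := y) hθ₄0 hP hU hγ (p.M * p.ε₂ / 2)
  have t5 := young_divergence (D := D) hθ₅0 hU hγ (p.M * p.ε₃ / 2)
  have t6 := mul_le_mul_of_nonneg_left (young_electrostatic (T := truncM p q) (y := y) hR hapos ha
    (fun i j => abs_trunc_le hR.le heps.le hφ d _) hγ) (half_pos hM).le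
  rw [e3] at t3
  rw [e5] at t5
  generalize frob (q - q₀) q = x1 at *
  generalize ∑ k, frob (D₀ k + D k) (D k) = x2 at *
  generalize frob (dF1 p q - dF2 p q₀) q = x3 at *
  generalize frob (Ptilde p q q₀ ⊙ vecMulVec U (y + γ)) q = x4 at *
  generalize (U + γ) ⬝ᵥ divA D = x5 at *
  generalize p.ε₁ * (y ⬝ᵥ y) + p.ε₁ * (γ ⬝ᵥ y) +
      (p.ε₂ * ((truncM p q *ᵥ y) ⬝ᵥ y) + p.ε₂ * ((truncM p q *ᵥ γ) ⬝ᵥ y)) = x6 at *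
  have hX := frob_self_nonneg q
  have hZ : 0 ≤ ∑ k, frob (D k) (D k) := Finset.sum_nonneg fun k _ => frob_self_nonneg _
  have hY := dotProduct_self_nonneg' y
  generalize frob q q = X at *
  generalize ∑ k, frob (D k) (D k) = Z at *
  generalize y ⬝ᵥ y = Y at *
  have k1 := mul_le_mul_of_nonneg_right hκ1 hX
  have k2 := mul_le_mul_of_nonneg_right hκ2 hZ
  have k3 := mul_le_mul_of_nonneg_right hκ3 hY
  have n1 : 0 ≤ δ * X := by positivity
  have n2 : 0 ≤ p.M * p.L * Z := by positivity
  have n3 : 0 ≤ p.M * a * Y := by positivity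
  linarith

end Coercive

/-! ### Joint continuity of the integrand in all its arguments. -/

section Continuity

variable {d : ℕ} {X : Type*} [TopologicalSpace X]

theorem continuous_frob {A B : X → Mat d} (hA : Continuous A) (hB : Continuous B) :
    Continuous fun x => frob (A x) (B x) :=
  continuous_finsetSum _ fun i _ => continuous_finsetSum _ fun j _ =>
    (hA.matrix_elem i j).mul (hB.matrix_elem i j)

theorem continuous_dF1 (p : Params) {A : X → Mat d} (hA : Continuous A) :
    Continuous fun x => dF1 p (A x) := by
  have h := hA.matrix_mul hA
  have ht := h.matrix_trace
  unfold dF1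
  fun_prop

theorem continuous_dF2 (p : Params) {A : X → Mat d} (hA : Continuous A) :
    Continuous fun x => dF2 p (A x) := by
  have ht := (hA.matrix_mul hA).matrix_trace
  unfold dF2
  fun_prop

theorem continuous_truncM {p : Params} (hτ : ContDiff ℝ 1 (trunc p d)) {A : X → Mat d}
    (hA : Continuous A) : Continuous fun x => truncM p (A x) :=
  continuous_matrix fun i j => hτ.continuous.comp (hA.matrix_elem i j)

theorem continuous_Ptilde {p : Params} (hτ : ContDiff ℝ 1 (trunc p d)) {A B : X → Mat d}
    (hA : Continuous A) (hB : Continuous B) : Continuous fun x => Ptilde p (A x) (B x) := by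
  refine continuous_matrix fun i j => ?_
  simp only [Ptilde_apply]
  exact (continuous_dslope_uncurry hτ).comp ((hA.matrix_elem i j).prodMk (hB.matrix_elem i j))

theorem continuous_divA {D : X → Fin d → Mat d} (hD : Continuous D) :
    Continuous fun x => divA (D x) :=
  continuous_pi fun i => continuous_finsetSum _ fun j _ =>
    ((continuous_apply j).comp hD).matrix_elem i j

theorem continuous_tfSym {A : X → Mat d} (hA : Continuous A) : Continuous fun x => tfSym (A x) :=
  (LinearMap.continuous_of_finiteDimensional (tfSym (d := d))).comp hA

theorem continuous_stepForm {p : Params} (hτ : ContDiff ℝ 1 (trunc p d))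
    {q₀ q ξ : X → Mat d} {D₀ D Ξ : X → Fin d → Mat d} {U γ y η : X → Fin d → ℝ}
    (hq₀ : Continuous q₀) (hD₀ : Continuous D₀) (hU : Continuous U) (hγ : Continuous γ)
    (hq : Continuous q) (hD : Continuous D) (hy : Continuous y)
    (hξ : Continuous ξ) (hΞ : Continuous Ξ) (hη : Continuous η) :
    Continuous fun x => stepForm p (q₀ x) (D₀ x) (U x) (γ x) (q x) (D x) (y x)
      (ξ x) (Ξ x) (η x) := by
  have hyγ := hy.add hγ
  have hP := continuous_Ptilde hτ hq hq₀
  have hA : Continuous fun x => Ptilde p (q x) (q₀ x) ⊙ vecMulVec (U x) (y x + γ x) :=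
    continuous_matrix fun i j => (hP.matrix_elem i j).mul
      (((continuous_apply i).comp hU).mul ((continuous_apply j).comp hyγ))
  have h1 := continuous_frob (hq.sub hq₀) hξ
  have h2 : Continuous fun x => ∑ k, frob (D₀ x k + D x k) (Ξ x k) :=
    continuous_finsetSum _ fun k _ => continuous_frob
      (((continuous_apply k).comp hD₀).add ((continuous_apply k).comp hD))
      ((continuous_apply k).comp hΞ)
  have h3 := continuous_frob ((continuous_dF1 p hq).sub (continuous_dF2 p hq₀)) hξ
  have h4 := continuous_frob hA hξ
  have h5 := (hU.add hyγ).dotProduct (continuous_divA hΞ)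
  have hT := (continuous_truncM hτ hq).matrix_mulVec hyγ
  have hdiv := continuous_divA hD
  have h6 : Continuous fun x => p.ε₁ • (y x + γ x) + p.ε₂ • (truncM p (q x) *ᵥ (y x + γ x)) +
      p.ε₃ • divA (D x) :=
    ((hyγ.const_smul p.ε₁).add (hT.const_smul p.ε₂)).add (hdiv.const_smul p.ε₃)
  have h7 := h6.dotProduct hη
  exact (((((h1.const_mul _).add (h2.const_mul _)).add (h3.const_mul _)).sub
    (h4.const_mul _)).sub (h5.const_mul _)).add (h7.const_mul _)

end Continuity

/-! ### The finite-dimensional problem -/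

section Jets

variable {d m : ℕ}

/-- The values and gradients of a finite family of functions at a point, together with two further
vectors (the gradients of the data). -/
abbrev Jet (d m : ℕ) : Type :=
  (Fin m → ℝ) × (Fin m → Fin d → ℝ) × (Fin d → ℝ) × (Fin d → ℝ)

/-- Coefficients of a matrix field and of a scalar function. -/
abbrev Coeff (d m : ℕ) : Type := (Fin m → Mat d) × (Fin m → ℝ)

/-- The value of the matrix field with coefficients `c`. -/
def fieldVal (z : Jet d m) (c : Fin m → Mat d) : Mat d := ∑ a, z.1 a • c a

/-- The partial derivatives of the matrix field with coefficients `c`. -/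
def fieldDer (z : Jet d m) (c : Fin m → Mat d) (k : Fin d) : Mat d := ∑ a, z.2.1 a k • c a

/-- The gradient of the scalar function with coefficients `w`. -/
def potGrad (z : Jet d m) (w : Fin m → ℝ) : Fin d → ℝ := ∑ a, w a • z.2.1 a

/-- The symmetric trace-free part of the field with coefficients `c`. -/
def tfVal (z : Jet d m) (c : Fin m → Mat d) : Mat d := tfSym (fieldVal z c)

/-- The partial derivatives of the symmetric trace-free part of the field. -/
def tfDer (z : Jet d m) (c : Fin m → Mat d) : Fin d → Mat d := fun k => tfSym (fieldDer z c k)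

theorem tfVal_add (z : Jet d m) (c c' : Fin m → Mat d) :
    tfVal z (c + c') = tfVal z c + tfVal z c' := by
  simp [tfVal, fieldVal, Finset.sum_add_distrib]

theorem tfVal_smul (z : Jet d m) (t : ℝ) (c : Fin m → Mat d) :
    tfVal z (t • c) = t • tfVal z c := by
  simp [tfVal, fieldVal, Finset.smul_sum, smul_comm t]

theorem tfDer_add (z : Jet d m) (c c' : Fin m → Mat d) :
    tfDer z (c + c') = tfDer z c + tfDer z c' := by
  funext k
  simp [tfDer, fieldDer, Finset.sum_add_distrib]

theorem tfDer_smul (z : Jet d m) (t : ℝ) (c : Fin m → Mat d) :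
    tfDer z (t • c) = t • tfDer z c := by
  funext k
  simp [tfDer, fieldDer, Finset.smul_sum, smul_comm t]

theorem potGrad_add (z : Jet d m) (w w' : Fin m → ℝ) :
    potGrad z (w + w') = potGrad z w + potGrad z w' := by
  simp [potGrad, add_smul, Finset.sum_add_distrib]

theorem potGrad_smul (z : Jet d m) (t : ℝ) (w : Fin m → ℝ) :
    potGrad z (t • w) = t • potGrad z w := by
  simp [potGrad, Finset.smul_sum, mul_smul]

section

variable {X : Type*} [TopologicalSpace X] {z : X → Jet d m} {c : X → Fin m → Mat d}
  {w : X → Fin m → ℝ}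

theorem continuous_fieldVal (hz : Continuous z) (hc : Continuous c) :
    Continuous fun x => fieldVal (z x) (c x) :=
  continuous_finsetSum _ fun a _ => ((continuous_apply a).comp hz.fst).smul
    ((continuous_apply a).comp hc)

theorem continuous_fieldDer (hz : Continuous z) (hc : Continuous c) :
    Continuous fun x => fieldDer (z x) (c x) :=
  continuous_pi fun k => continuous_finsetSum _ fun a _ =>
    ((continuous_apply k).comp ((continuous_apply a).comp hz.snd.fst)).smul
      ((continuous_apply a).comp hc)

theorem continuous_potGrad (hz : Continuous z) (hw : Continuous w) :
    Continuous fun x => potGrad (z x) (w x) :=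
  continuous_finsetSum _ fun a _ => ((continuous_apply a).comp hw).smul
    ((continuous_apply a).comp hz.snd.fst)

theorem continuous_tfVal (hz : Continuous z) (hc : Continuous c) :
    Continuous fun x => tfVal (z x) (c x) :=
  continuous_tfSym (continuous_fieldVal hz hc)

theorem continuous_tfDer (hz : Continuous z) (hc : Continuous c) :
    Continuous fun x => tfDer (z x) (c x) :=
  continuous_pi fun k => continuous_tfSym ((continuous_apply k).comp (continuous_fieldDer hz hc))

end

theorem locallyCompactSpace_mat (d : ℕ) : LocallyCompactSpace (Mat d) := by
  change LocallyCompactSpace (Fin d → Fin d → ℝ)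
  infer_instance

theorem firstCountableTopology_mat (d : ℕ) : FirstCountableTopology (Mat d) := by
  change FirstCountableTopology (Fin d → Fin d → ℝ)
  infer_instance

/-- The integrand of the scheme in terms of coefficients. -/
def jetForm (p : Params) (c₀ : Fin m → Mat d) (x y : Coeff d m) (z : Jet d m) : ℝ :=
  stepForm p (tfVal z c₀) (tfDer z c₀) z.2.2.1 z.2.2.2 (tfVal z x.1) (tfDer z x.1) (potGrad z x.2)
    (tfVal z y.1) (tfDer z y.1) (potGrad z y.2)

/-- The energy density that measures coercivity. -/
def jetEnergy (x : Coeff d m) (z : Jet d m) : ℝ :=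
  frob (tfVal z x.1) (tfVal z x.1) + ∑ k, frob (tfDer z x.1 k) (tfDer z x.1 k) +
    potGrad z x.2 ⬝ᵥ potGrad z x.2

section

variable {X : Type*} [TopologicalSpace X] {x : X → Coeff d m} {z : X → Jet d m}

theorem continuous_jetForm {p : Params} (hτ : ContDiff ℝ 1 (trunc p d)) (c₀ : Fin m → Mat d)
    (y : Coeff d m) (hx : Continuous x) (hz : Continuous z) :
    Continuous fun s => jetForm p c₀ (x s) y (z s) :=
  continuous_stepForm hτ (continuous_tfVal hz continuous_const)
    (continuous_tfDer hz continuous_const) hz.snd.snd.fst hz.snd.snd.snd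
    (continuous_tfVal hz hx.fst) (continuous_tfDer hz hx.fst) (continuous_potGrad hz hx.snd)
    (continuous_tfVal hz continuous_const) (continuous_tfDer hz continuous_const)
    (continuous_potGrad hz continuous_const)

theorem continuous_jetEnergy (hx : Continuous x) (hz : Continuous z) :
    Continuous fun s => jetEnergy (x s) (z s) := by
  have h1 := continuous_tfVal hz hx.fst
  have h2 := continuous_tfDer hz hx.fst
  have h3 := continuous_potGrad hz hx.snd
  exact ((continuous_frob h1 h1).add (continuous_finsetSum _ fun k _ =>
    continuous_frob (continuous_pi_iff.1 h2 k) (continuous_pi_iff.1 h2 k))).add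
    (h3.dotProduct h3)

end

theorem jetEnergy_nonneg (x : Coeff d m) (z : Jet d m) : 0 ≤ jetEnergy x z :=
  add_nonneg (add_nonneg (frob_self_nonneg _) (Finset.sum_nonneg fun _ _ => frob_self_nonneg _))
    (dotProduct_self_nonneg' _)

theorem jetEnergy_smul (t : ℝ) (x : Coeff d m) (z : Jet d m) :
    jetEnergy (t • x) z = t ^ 2 * jetEnergy x z := by
  simp only [jetEnergy, Prod.smul_fst, Prod.smul_snd, tfVal_smul, tfDer_smul, potGrad_smul,
    frob_smul_left, frob_smul_right, Pi.smul_apply, smul_dotProduct, dotProduct_smul, smul_eq_mul,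
    ← Finset.mul_sum]
  ring

theorem jetEnergy_eq_zero {x : Coeff d m} {z : Jet d m} (h : jetEnergy x z = 0) :
    tfVal z x.1 = 0 ∧ tfDer z x.1 = 0 ∧ potGrad z x.2 = 0 := by
  have h1 := frob_self_nonneg (tfVal z x.1)
  have h2 : 0 ≤ ∑ k, frob (tfDer z x.1 k) (tfDer z x.1 k) :=
    Finset.sum_nonneg fun _ _ => frob_self_nonneg _
  have h3 := dotProduct_self_nonneg' (potGrad z x.2)
  unfold jetEnergy at h
  refine ⟨eq_zero_of_frob_self (by linarith), funext fun k => eq_zero_of_frob_self ?_,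
    dotProduct_self_eq_zero.1 (by linarith)⟩
  exact (Finset.sum_eq_zero_iff_of_nonneg fun _ _ => frob_self_nonneg _).1 (by linarith) k
    (Finset.mem_univ k)

theorem jetForm_add (p : Params) (c₀ : Fin m → Mat d) (x y y' : Coeff d m) (z : Jet d m) :
    jetForm p c₀ x (y + y') z = jetForm p c₀ x y z + jetForm p c₀ x y' z := by
  simp only [jetForm, Prod.fst_add, Prod.snd_add, tfVal_add, tfDer_add, potGrad_add, stepForm_add]

theorem jetForm_smul (p : Params) (c₀ : Fin m → Mat d) (x : Coeff d m) (t : ℝ) (y : Coeff d m)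
    (z : Jet d m) : jetForm p c₀ x (t • y) z = t * jetForm p c₀ x y z := by
  simp only [jetForm, Prod.smul_fst, Prod.smul_snd, tfVal_smul, tfDer_smul, potGrad_smul,
    stepForm_smul]

/-- The nonlinear system of one time step has a solution. -/
theorem exists_jet_solution {X : Type*} [MeasurableSpace X] {μ : Measure X} [IsFiniteMeasure μ]
    {p : Params} (hd : d ≠ 0) (hL : 0 < p.L) (hM : 0 < p.M)
    (hR : 0 < p.R) (hdt : 0 < p.dt) (heps : 0 < p.eps) (hφ : IsMollifier p.φ p.eps)
    (hβ₁ : |p.b| ≤ p.β₁) (hβ₂ : |p.b| ≤ p.β₂) (hε : |p.ε₂| * p.R < p.ε₁)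
    {h : X → Jet d m} (hh : AEStronglyMeasurable h μ) {r : ℝ} (hr : ∀ᵐ x ∂μ, ‖h x‖ ≤ r)
    (c₀ : Fin m → Mat d) : ∃ x : Coeff d m, ∀ y, ∫ s, jetForm p c₀ x y (h s) ∂μ = 0 := by
  have hτ := contDiff_trunc hR.le heps.le hφ d
  have := locallyCompactSpace_mat d
  have := firstCountableTopology_mat d
  have hfc : ∀ x y, Continuous (jetForm p c₀ x y) := fun x y =>
    continuous_jetForm hτ c₀ y continuous_const continuous_id
  have hEc' : ∀ x : Coeff d m, Continuous (jetEnergy x) := fun x =>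
    continuous_jetEnergy continuous_const continuous_id
  have hint : ∀ x y, Integrable (fun s => jetForm p c₀ x y (h s)) μ := fun x y =>
    integrable_comp_of_bounded hh hr (hfc x y)
  have hintE : ∀ x, Integrable (fun s => jetEnergy x (h s)) μ := fun x =>
    integrable_comp_of_bounded hh hr (hEc' x)
  let B : Coeff d m → Coeff d m →ₗ[ℝ] ℝ := fun x =>
    { toFun := fun y => ∫ s, jetForm p c₀ x y (h s) ∂μ
      map_add' := fun y y' => by
        simp only [jetForm_add]
        exact integral_add (hint x y) (hint x y')
      map_smul' := fun t y => by
        simp only [jetForm_smul, integral_const_mul, RingHom.id_apply, smul_eq_mul] }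
  -- Coefficients that the integrals do not see: those removed by `tfSym`, and linear relations of
  -- the family on the domain.
  let N : Submodule ℝ (Coeff d m) :=
    { carrier := {x | ∀ᵐ s ∂μ, tfVal (h s) x.1 = 0 ∧ tfDer (h s) x.1 = 0 ∧ potGrad (h s) x.2 = 0}
      add_mem' := fun {x y} hx hy => by
        simp only [Set.mem_ofPred_eq] at hx hy ⊢
        filter_upwards [hx, hy] with s h1 h2
        simp [tfVal_add, tfDer_add, potGrad_add, h1, h2]
      zero_mem' := by
        simp only [Set.mem_ofPred_eq]
        refine Eventually.of_forall fun s => ?_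
        simp [tfVal, tfDer, potGrad, fieldVal, fieldDer, funext_iff]
      smul_mem' := fun t x hx => by
        simp only [Set.mem_ofPred_eq] at hx ⊢
        filter_upwards [hx] with s h1
        simp [tfVal_smul, tfDer_smul, potGrad_smul, h1] }
  have q₀c : Continuous fun z : Jet d m => tfVal z c₀ := continuous_tfVal continuous_id continuous_const
  have D₀c : Continuous fun z : Jet d m => tfDer z c₀ := continuous_tfDer continuous_id continuous_const
  obtain ⟨K₁, hK₁⟩ := exists_bound_comp hr (continuous_frob q₀c q₀c)
  obtain ⟨K₂, hK₂⟩ := exists_bound_comp hr (f := fun z => ∑ k, frob (tfDer z c₀ k) (tfDer z c₀ k))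
    (continuous_finsetSum _ fun k _ => continuous_frob (continuous_pi_iff.1 D₀c k)
      (continuous_pi_iff.1 D₀c k))
  obtain ⟨K₃, hK₃⟩ := exists_bound_comp hr
    (continuous_frob (continuous_dF2 p q₀c) (continuous_dF2 p q₀c))
  obtain ⟨K₄, hK₄⟩ := exists_bound_comp hr (f := fun z : Jet d m => z.2.2.1 ⬝ᵥ z.2.2.1)
    (continuous_snd.snd.fst.dotProduct continuous_snd.snd.fst)
  obtain ⟨K₅, hK₅⟩ := exists_bound_comp hr (f := fun z : Jet d m => z.2.2.2 ⬝ᵥ z.2.2.2)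
    (continuous_snd.snd.snd.dotProduct continuous_snd.snd.snd)
  obtain ⟨κ, C, hκ, hco⟩ := exists_stepForm_coercive hd hL hM hR hdt heps hφ hβ₁ hβ₂ hε
    (max K₁ (max K₂ (max K₃ (max K₄ K₅))))
  -- The old data are essentially bounded, so a single pair `κ`, `C` serves almost every point.
  -- Projected fields meet the symmetry and trace conditions of the pointwise estimate.
  have hBcoe : ∀ x, κ * (∫ s, jetEnergy x (h s) ∂μ) - C * μ.real Set.univ ≤ B x x := by
    intro x
    have h1 : ∫ s, (κ * jetEnergy x (h s) - C) ∂μ ≤ ∫ s, jetForm p c₀ x x (h s) ∂μ := by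
      have hI : Integrable (fun s => κ * jetEnergy x (h s) - C) μ :=
        ((hintE x).const_mul κ).sub (integrable_const C)
      refine integral_mono_ae hI (hint x x) ?_
      change ∀ᵐ s ∂μ, κ * jetEnergy x (h s) - C ≤ jetForm p c₀ x x (h s)
      filter_upwards [hK₁, hK₂, hK₃, hK₄, hK₅] with s k1 k2 k3 k4 k5
      refine hco (tfVal (h s) c₀) (tfDer (h s) c₀) (h s).2.2.1 (h s).2.2.2 (tfVal (h s) x.1)
        (tfDer (h s) x.1) (potGrad (h s) x.2) ?_ ?_ ?_ ?_ ?_ (tfSym_isSymm _) (trace_tfSym hd _)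
      · exact (le_abs_self _).trans (k1.trans (by simp))
      · exact (le_abs_self _).trans (k2.trans (by simp))
      · exact (le_abs_self _).trans (k3.trans (by simp))
      · exact (le_abs_self _).trans (k4.trans (by simp))
      · exact (le_abs_self _).trans (k5.trans (by simp))
    rw [integral_sub ((hintE x).const_mul κ) (integrable_const C), integral_const_mul,
      integral_const, smul_eq_mul, mul_comm (μ.real _)] at h1
    exact h1
  have hBc : ∀ y, Continuous fun x => B x y := fun y =>
    continuous_integral_of_bounded hh hr (continuous_jetForm hτ c₀ y continuous_fst continuous_snd)
  have hEc : Continuous fun x : Coeff d m => ∫ s, jetEnergy x (h s) ∂μ :=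
    continuous_integral_of_bounded hh hr (continuous_jetEnergy continuous_fst continuous_snd)
  refine exists_zero_of_coercive B hBc N ?_ _ hEc ?_ ?_ hκ hBcoe
  · intro x n hn
    refine integral_eq_zero_of_ae ?_
    filter_upwards [hn] with s hs
    simp only [jetForm, hs.1, hs.2.1, hs.2.2, stepForm_zero, Pi.zero_apply]
  · intro t x
    simp only [jetEnergy_smul, integral_const_mul]
  · intro x hx
    refine lt_of_le_of_ne (integral_nonneg fun s => jetEnergy_nonneg x _) fun h0 => hx ?_
    have := (integral_eq_zero_iff_of_nonneg (fun s => jetEnergy_nonneg x _) (hintE x)).1 h0.symm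
    filter_upwards [this] with s hs
    exact jetEnergy_eq_zero hs

end Jets

/-! ### From coefficients to finite element functions -/

section Fields

variable {d : ℕ}

/-- The entries of `F` are differentiable at `x` and `D k` is the `k`-th partial derivative. -/
def HasPartials (F : Pt d → Mat d) (x : Pt d) (D : Fin d → Mat d) : Prop :=
  ∀ i j, DifferentiableAt ℝ (fun y => F y i j) x ∧ ∀ k, pd k (fun y => F y i j) x = D k i j

theorem pd_congr {v w : Pt d → ℝ} {x : Pt d} (h : v =ᶠ[𝓝 x] w) (k : Fin d) :
    pd k v x = pd k w x := by
  rw [pd, pd, h.fderiv_eq]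

theorem pd_half_add {v w : Pt d → ℝ} {x : Pt d} (hv : DifferentiableAt ℝ v x)
    (hw : DifferentiableAt ℝ w x) (k : Fin d) :
    pd k (fun y => 1 / 2 * (v y + w y)) x = 1 / 2 * (pd k v x + pd k w x) := by
  rw [pd_const_mul (hv.fun_add hw), pd_add hv hw]

theorem pd_linearCombination {m : ℕ} {f : Fin m → Pt d → ℝ} {x : Pt d}
    (hf : ∀ a, DifferentiableAt ℝ (f a) x) (w : Fin m → ℝ) (k : Fin d) :
    pd k (fun y => ∑ a, w a * f a y) x = ∑ a, w a * pd k (f a) x := by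
  rw [pd_sum fun a _ => (hf a).const_mul (w a)]
  exact Finset.sum_congr rfl fun a _ => pd_const_mul (hf a) _ _

theorem differentiableAt_linearCombination {m : ℕ} {f : Fin m → Pt d → ℝ} {x : Pt d}
    (hf : ∀ a, DifferentiableAt ℝ (f a) x) (w : Fin m → ℝ) :
    DifferentiableAt ℝ (fun y => ∑ a, w a * f a y) x :=
  DifferentiableAt.fun_sum fun a _ => (hf a).const_mul (w a)

/-- Equality near `x` is all that can be asked: coefficients represent a field on the closure of `Ω`
only. -/
theorem hasPartials_of_eventuallyEq {m : ℕ} {f : Fin m → Pt d → ℝ} {x : Pt d}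
    (hf : ∀ a, DifferentiableAt ℝ (f a) x) {F : Pt d → Mat d} {C : Fin m → Mat d}
    (hF : ∀ᶠ y in 𝓝 x, F y = ∑ a, f a y • C a) :
    HasPartials F x fun k => ∑ a, pd k (f a) x • C a := by
  intro i j
  have h : (fun y => F y i j) =ᶠ[𝓝 x] fun y => ∑ a, C a i j * f a y := by
    filter_upwards [hF] with y hy
    simp [hy, Matrix.sum_apply, mul_comm]
  refine ⟨(differentiableAt_linearCombination hf _).congr_of_eventuallyEq h, fun k => ?_⟩
  rw [pd_congr h, pd_linearCombination hf]
  simp [Matrix.sum_apply, mul_comm]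

theorem HasPartials.divM_eq {F : Pt d → Mat d} {x : Pt d} {D : Fin d → Mat d}
    (h : HasPartials F x D) : divM F x = divA D := by
  funext i
  exact Finset.sum_congr rfl fun j _ => (h i j).2 j

theorem HasPartials.symPart {F : Pt d → Mat d} {x : Pt d} {D : Fin d → Mat d}
    (h : HasPartials F x D) : HasPartials (fun y => symPart (F y)) x fun k => symPart (D k) := by
  intro i j
  have heq : (fun y => QTensorScheme.symPart (F y) i j) = fun y => 1 / 2 * (F y i j + F y j i) := by
    funext y
    simp [QTensorScheme.symPart]
  rw [heq]
  refine ⟨((h i j).1.add (h j i).1).const_mul _, fun k => ?_⟩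
  refine (pd_half_add (h i j).1 (h j i).1 k).trans ?_
  rw [(h i j).2, (h j i).2]
  simp [QTensorScheme.symPart]

theorem HasPartials.grad_trace {F : Pt d → Mat d} {x : Pt d} {D : Fin d → Mat d}
    (h : HasPartials F x D) : grad (fun y => (F y).trace) x = fun k => (D k).trace := by
  funext k
  simp only [grad, Matrix.trace, Matrix.diag_apply]
  rw [pd_sum fun i _ => (h i i).1]
  exact Finset.sum_congr rfl fun i _ => (h i i).2 k

theorem HasPartials.gradM_half {P Q Φ : Pt d → Mat d} {x : Pt d} {P' Q' Φ' : Fin d → Mat d}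
    (hP : HasPartials P x P') (hQ : HasPartials Q x Q') (hΦ : HasPartials Φ x Φ') :
    gradM (fun y => (1 / 2 : ℝ) • (P y + Q y)) Φ x =
      1 / 2 * ∑ k, frob (P' k + Q' k) (Φ' k) := by
  have hk : ∀ i j k, pd k (fun y => ((1 / 2 : ℝ) • (P y + Q y)) i j) x =
      1 / 2 * (P' k i j + Q' k i j) := fun i j k => by
    simp only [Matrix.smul_apply, Matrix.add_apply, smul_eq_mul]
    refine (pd_half_add (hP i j).1 (hQ i j).1 k).trans ?_
    rw [(hP i j).2, (hQ i j).2]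
  simp only [gradM, hk, (hΦ _ _).2, frob, Matrix.add_apply, Finset.mul_sum]
  calc ∑ i, ∑ j, ∑ k, 1 / 2 * (P' k i j + Q' k i j) * Φ' k i j
      = ∑ i, ∑ k, ∑ j, 1 / 2 * (P' k i j + Q' k i j) * Φ' k i j :=
        Finset.sum_congr rfl fun i _ => Finset.sum_comm
    _ = ∑ k, ∑ i, ∑ j, 1 / 2 * (P' k i j + Q' k i j) * Φ' k i j := Finset.sum_comm
    _ = _ := by simp only [mul_assoc]

/-- The row-wise divergence of a scalar field times the identity is the gradient of that field, so
the `ε₃` expression of the scheme is the divergence of the projected test field. -/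
theorem dotProduct_divA_tfSym (w : Fin d → ℝ) (D : Fin d → Mat d) :
    w ⬝ᵥ divA (fun k => symPart (D k)) - (1 / d : ℝ) * (w ⬝ᵥ fun k => (D k).trace) =
      w ⬝ᵥ divA fun k => tfSym (D k) := by
  have h : divA (fun k => tfSym (D k)) =
      divA (fun k => symPart (D k)) - (1 / d : ℝ) • fun k => (D k).trace := by
    funext i
    simp [divA, tfSym_apply, Matrix.one_apply]
  rw [h, dotProduct_sub, dotProduct_smul, smul_eq_mul]

theorem grad_half {u u' : Pt d → ℝ} {x : Pt d} (hu : DifferentiableAt ℝ u x)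
    (hu' : DifferentiableAt ℝ u' x) :
    grad (fun y => (u y + u' y) / 2) x = (1 / 2 : ℝ) • (grad u x + grad u' x) := by
  funext k
  have : (fun y => (u y + u' y) / 2) = fun y => 1 / 2 * (u y + u' y) := by
    funext y
    ring
  simp only [grad, this, Pi.smul_apply, Pi.add_apply, smul_eq_mul]
  exact pd_half_add hu hu' k

theorem grad_add {u u' : Pt d → ℝ} {x : Pt d} (hu : DifferentiableAt ℝ u x)
    (hu' : DifferentiableAt ℝ u' x) :
    grad (fun y => u y + u' y) x = grad u x + grad u' x :=
  funext fun k => pd_add hu hu' k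

end Fields

section Bounds

variable {X : Type*} [MeasurableSpace X] {μ : Measure X}

theorem exists_ae_bound_pi {ι : Type*} [Fintype ι] {E : ι → Type*}
    [∀ i, SeminormedAddCommGroup (E i)] {F : X → ∀ i, E i}
    (h : ∀ i, ∃ r, ∀ᵐ x ∂μ, ‖F x i‖ ≤ r) : ∃ r, ∀ᵐ x ∂μ, ‖F x‖ ≤ r := by
  choose r hr using h
  refine ⟨∑ i, |r i|, ?_⟩
  filter_upwards [ae_all_iff.2 hr] with x hx
  refine (pi_norm_le_iff_of_nonneg (Finset.sum_nonneg fun i _ => abs_nonneg _)).2 fun i => ?_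
  exact (hx i).trans ((le_abs_self _).trans
    (Finset.single_le_sum (f := fun i => |r i|) (fun i _ => abs_nonneg _) (Finset.mem_univ i)))

theorem exists_ae_bound_prodMk {E F : Type*} [SeminormedAddCommGroup E] [SeminormedAddCommGroup F]
    {f : X → E} {g : X → F} (hf : ∃ r, ∀ᵐ x ∂μ, ‖f x‖ ≤ r) (hg : ∃ r, ∀ᵐ x ∂μ, ‖g x‖ ≤ r) :
    ∃ r, ∀ᵐ x ∂μ, ‖(f x, g x)‖ ≤ r := by
  obtain ⟨r, hr⟩ := hf
  obtain ⟨s, hs⟩ := hg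
  refine ⟨max r s, ?_⟩
  filter_upwards [hr, hs] with x h1 h2
  exact max_le_max h1 h2

end Bounds

section Step

variable {d m : ℕ} {Ω : Set (Pt d)} {𝒯 : Geometry.SimplicialComplex ℝ (Pt d)}

/-- The jet at `x` of a finite family `f`, together with the gradients of `u` and `g`. -/
def jetAt (f : Fin m → Pt d → ℝ) (u g : Pt d → ℝ) (x : Pt d) : Jet d m :=
  (fun a => f a x, fun a => grad (f a) x, grad u x, grad g x)

theorem measurable_grad (v : Pt d → ℝ) : Measurable (grad v) :=
  measurable_pi_lambda _ fun _ => measurable_fderiv_apply_const ℝ v _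

theorem aestronglyMeasurable_jetAt {f : Fin m → Pt d → ℝ}
    (hf : ∀ a, AEStronglyMeasurable (f a) (volume.restrict Ω)) (u g : Pt d → ℝ) :
    AEStronglyMeasurable (jetAt f u g) (volume.restrict Ω) := by
  have h1 : AEMeasurable (fun x a => f a x) (volume.restrict Ω) :=
    aemeasurable_pi_lambda _ fun a => (hf a).aemeasurable
  have h2 : Measurable fun x a => grad (f a) x := measurable_pi_lambda _ fun a => measurable_grad _
  exact (h1.prodMk (h2.prodMk
    ((measurable_grad u).prodMk (measurable_grad g))).aemeasurable).aestronglyMeasurable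

theorem IsPiecewiseP1.exists_ae_bound_grad (h𝒯 : IsTriangulation 𝒯 Ω) (hΩ : IsOpen Ω)
    {v : Pt d → ℝ} (hv : IsPiecewiseP1 𝒯 v) :
    ∃ r, ∀ᵐ x ∂volume.restrict Ω, ‖grad v x‖ ≤ r := by
  obtain ⟨K, hK⟩ := hv.exists_bound_pd h𝒯
  refine exists_ae_bound_pi fun k => ⟨K, ?_⟩
  filter_upwards [h𝒯.ae_mem_cellInteriors hΩ] with x hx
  exact hK x hx k

theorem exists_ae_bound_jetAt (h𝒯 : IsTriangulation 𝒯 Ω) (hΩ : IsOpen Ω)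
    {f : Fin m → Pt d → ℝ} (hf : ∀ a, IsPiecewiseP1 𝒯 (f a)) {u g : Pt d → ℝ}
    (hu : IsPiecewiseP1 𝒯 u) (hg : IsPiecewiseP1 𝒯 g) :
    ∃ r, ∀ᵐ x ∂volume.restrict Ω, ‖jetAt f u g x‖ ≤ r := by
  refine exists_ae_bound_prodMk (exists_ae_bound_pi fun a => ?_) (exists_ae_bound_prodMk
    (exists_ae_bound_pi fun a => (hf a).exists_ae_bound_grad h𝒯 hΩ) (exists_ae_bound_prodMk
    (hu.exists_ae_bound_grad h𝒯 hΩ) (hg.exists_ae_bound_grad h𝒯 hΩ)))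
  obtain ⟨K, hK⟩ := (hf a).exists_bound h𝒯
  refine ⟨K, ?_⟩
  filter_upwards [ae_restrict_mem hΩ.measurableSet] with x hx
  exact hK x (subset_closure hx)

/-- A field in `X_h` is determined on the closure of `Ω` by its coefficients. -/
theorem exists_coeff_of_mem_Xh {f : Fin m → Pt d → ℝ}
    (hspan : ∀ v ∈ Yh Ω 𝒯, ∃ w : Fin m → ℝ, ∀ x ∈ closure Ω, v x = ∑ a, w a * f a x)
    {Φ : Pt d → Mat d} (hΦ : Φ ∈ Xh Ω 𝒯) :
    ∃ C : Fin m → Mat d, ∀ x ∈ closure Ω, Φ x = ∑ a, f a x • C a := by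
  choose w hw using fun i j => hspan (fun x => Φ x i j) (hΦ i j)
  refine ⟨fun a => Matrix.of fun i j => w i j a, fun x hx => ?_⟩
  ext i j
  rw [hw i j x hx]
  simp [Matrix.sum_apply, mul_comm]

theorem jetForm_field (p : Params) (c₀ : Fin m → Mat d) (s : Coeff d m) (C : Fin m → Mat d)
    (z : Jet d m) : jetForm p c₀ s (C, 0) z =
      1 / p.dt * frob (tfVal z s.1 - tfVal z c₀) (tfVal z C)
      + p.M * p.L / 2 * ∑ k, frob (tfDer z c₀ k + tfDer z s.1 k) (tfDer z C k)
      + p.M * frob (dF1 p (tfVal z s.1) - dF2 p (tfVal z c₀)) (tfVal z C)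
      - p.M * p.ε₂ / 2 * frob (Ptilde p (tfVal z s.1) (tfVal z c₀) ⊙
          vecMulVec z.2.2.1 (potGrad z s.2 + z.2.2.2)) (tfVal z C)
      - p.M * p.ε₃ / 2 * ((z.2.2.1 + (potGrad z s.2 + z.2.2.2)) ⬝ᵥ divA (tfDer z C)) := by
  have h : potGrad z (0 : Fin m → ℝ) = 0 := by simp [potGrad]
  simp [jetForm, stepForm, h]

theorem jetForm_potential (p : Params) (c₀ : Fin m → Mat d) (s : Coeff d m) (w : Fin m → ℝ)
    (z : Jet d m) : jetForm p c₀ s (0, w) z =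
      p.M / 2 * ((p.ε₁ • (potGrad z s.2 + z.2.2.2) +
        p.ε₂ • (truncM p (tfVal z s.1) *ᵥ (potGrad z s.2 + z.2.2.2)) +
        p.ε₃ • divA (tfDer z s.1)) ⬝ᵥ potGrad z w) := by
  have h1 : tfVal z (0 : Fin m → Mat d) = 0 := by simp [tfVal, fieldVal]
  have h2 : tfDer z (0 : Fin m → Mat d) = 0 := by
    funext k
    simp [tfDer, fieldDer]
  have h3 : divA (0 : Fin d → Mat d) = 0 := by
    funext i
    simp [divA]
  simp [jetForm, stepForm, h1, h2, h3, frob_zero_right]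

theorem integral_five {X : Type*} [MeasurableSpace X] {μ : Measure X} {f₁ f₂ f₃ f₄ f₅ : X → ℝ}
    (h₁ : Integrable f₁ μ) (h₂ : Integrable f₂ μ) (h₃ : Integrable f₃ μ) (h₄ : Integrable f₄ μ)
    (h₅ : Integrable f₅ μ) (a₁ a₂ a₃ a₄ a₅ : ℝ) :
    ∫ x, (a₁ * f₁ x + a₂ * f₂ x + a₃ * f₃ x - a₄ * f₄ x - a₅ * f₅ x) ∂μ =
      a₁ * ∫ x, f₁ x ∂μ + a₂ * ∫ x, f₂ x ∂μ + a₃ * ∫ x, f₃ x ∂μ - a₄ * ∫ x, f₄ x ∂μ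
        - a₅ * ∫ x, f₅ x ∂μ := by
  have i₁ := h₁.const_mul a₁
  have i₂ := h₂.const_mul a₂
  have i₃ := h₃.const_mul a₃
  have i₄ := h₄.const_mul a₄
  have i₅ := h₅.const_mul a₅
  have j₂ : Integrable (fun x => a₁ * f₁ x + a₂ * f₂ x) μ := i₁.add i₂
  have j₃ : Integrable (fun x => a₁ * f₁ x + a₂ * f₂ x + a₃ * f₃ x) μ := j₂.add i₃
  have j₄ : Integrable (fun x => a₁ * f₁ x + a₂ * f₂ x + a₃ * f₃ x - a₄ * f₄ x) μ := j₃.sub i₄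
  rw [integral_sub j₄ i₅, integral_sub j₃ i₄, integral_add j₂ i₃, integral_add i₁ i₂]
  simp only [integral_const_mul]

end Step

/-! ### From the coefficient system to the weak equations of one step. -/

section Step

variable {d m : ℕ} {Ω : Set (Pt d)} {𝒯 : Geometry.SimplicialComplex ℝ (Pt d)}

theorem tfVal_eq_sum (z : Jet d m) (c : Fin m → Mat d) :
    tfVal z c = ∑ a, z.1 a • tfSym (c a) := by
  simp [tfVal, fieldVal]

theorem tfDer_eq_sum (z : Jet d m) (c : Fin m → Mat d) (k : Fin d) :
    tfDer z c k = ∑ a, z.2.1 a k • tfSym (c a) := by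
  simp [tfDer, fieldDer]

/-- The discrete evolution equation follows from the equation for the coefficients. -/
theorem qEquation_of_jetForm (hd : d ≠ 0) (hΩ : IsOpen Ω) (h𝒯 : IsTriangulation 𝒯 Ω) {p : Params}
    (hτ : ContDiff ℝ 1 (trunc p d)) {f : Fin m → Pt d → ℝ} (hf : ∀ a, f a ∈ Yh Ω 𝒯)
    (hspan : ∀ v ∈ Yh Ω 𝒯, ∃ w : Fin m → ℝ, ∀ x ∈ closure Ω, v x = ∑ a, w a * f a x)
    {u g : Pt d → ℝ} (hu : IsPiecewiseP1 𝒯 u) (hg : IsPiecewiseP1 𝒯 g)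
    {Q : Pt d → Mat d} (hQ : IsQTensor Ω Q) {c₀ : Fin m → Mat d}
    (hc₀ : ∀ x ∈ closure Ω, Q x = ∑ a, f a x • c₀ a) {s : Coeff d m}
    (hs : ∀ y, ∫ x in Ω, jetForm p c₀ s y (jetAt f u g x) = 0) :
    QEquation p Ω 𝒯 Q (fun x => ∑ a, f a x • tfSym (s.1 a)) u
      (fun x => (∑ a, s.2 a * f a x) + g x) := by
  intro Φ hΦ
  obtain ⟨C, hC⟩ := exists_coeff_of_mem_Xh hspan hΦ
  have := h𝒯.isFiniteMeasure
  have hmeas := aestronglyMeasurable_jetAt (fun a => (hf a).1.1.1.1) u g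
  obtain ⟨r, hr⟩ := exists_ae_bound_jetAt h𝒯 hΩ (fun a => (hf a).2) hu hg
  have hint : ∀ F : Jet d m → ℝ, Continuous F →
      Integrable (fun x => F (jetAt f u g x)) (volume.restrict Ω) := fun F hF =>
    integrable_comp_of_bounded hmeas hr hF
  have cid : Continuous fun z : Jet d m => z := continuous_id
  have cq₀ : Continuous fun z : Jet d m => tfVal z c₀ := continuous_tfVal cid continuous_const
  have cq : Continuous fun z : Jet d m => tfVal z s.1 := continuous_tfVal cid continuous_const
  have cξ : Continuous fun z : Jet d m => tfVal z C := continuous_tfVal cid continuous_const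
  have cD₀ : Continuous fun z : Jet d m => tfDer z c₀ := continuous_tfDer cid continuous_const
  have cD : Continuous fun z : Jet d m => tfDer z s.1 := continuous_tfDer cid continuous_const
  have cΞ : Continuous fun z : Jet d m => tfDer z C := continuous_tfDer cid continuous_const
  have cU : Continuous fun z : Jet d m => z.2.2.1 := continuous_snd.snd.fst
  have cy : Continuous fun z : Jet d m => potGrad z s.2 + z.2.2.2 :=
    (continuous_potGrad cid continuous_const).add continuous_snd.snd.snd
  have cA : Continuous fun z : Jet d m => Ptilde p (tfVal z s.1) (tfVal z c₀) ⊙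
      vecMulVec z.2.2.1 (potGrad z s.2 + z.2.2.2) :=
    continuous_matrix fun i j => ((continuous_Ptilde hτ cq cq₀).matrix_elem i j).mul
      (((continuous_apply i).comp cU).mul ((continuous_apply j).comp cy))
  have i₁ := hint (fun z => frob (tfVal z s.1 - tfVal z c₀) (tfVal z C))
    (continuous_frob (cq.sub cq₀) cξ)
  have i₂ := hint (fun z => ∑ k, frob (tfDer z c₀ k + tfDer z s.1 k) (tfDer z C k))
    (continuous_finsetSum _ fun k _ => continuous_frob
      ((continuous_pi_iff.1 cD₀ k).add (continuous_pi_iff.1 cD k)) (continuous_pi_iff.1 cΞ k))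
  have i₃ := hint (fun z => frob (dF1 p (tfVal z s.1) - dF2 p (tfVal z c₀)) (tfVal z C))
    (continuous_frob ((continuous_dF1 p cq).sub (continuous_dF2 p cq₀)) cξ)
  have i₄ := hint _ (continuous_frob cA cξ)
  have i₅ := hint (fun z => (z.2.2.1 + (potGrad z s.2 + z.2.2.2)) ⬝ᵥ divA (tfDer z C))
    ((cU.add cy).dotProduct (continuous_divA cΞ))
  -- A zero potential in the test direction isolates the evolution equation.
  have hsum := hs (C, 0)
  simp only [jetForm_field] at hsum
  rw [integral_five i₁ i₂ i₃ i₄ i₅] at hsum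
  have hgood : ∀ᵐ x ∂volume.restrict Ω, x ∈ Ω ∧ x ∈ cellInteriors 𝒯 :=
    (ae_restrict_mem hΩ.measurableSet).and (h𝒯.ae_mem_cellInteriors hΩ)
  -- Projecting the coefficients of `Q` changes nothing on `Ω`, where `Q` is already symmetric and
  -- trace-free. As `Ω` is open, this also determines the derivatives there.
  have hQval : ∀ x ∈ Ω, Q x = tfVal (jetAt f u g x) c₀ := fun x hx => by
    rw [← tfSym_eq_self (hQ x hx).1 (hQ x hx).2, hc₀ x (subset_closure hx)]
    rfl
  have hQ'val : ∀ x, ∑ a, f a x • tfSym (s.1 a) = tfVal (jetAt f u g x) s.1 := fun x =>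
    (tfVal_eq_sum (jetAt f u g x) s.1).symm
  have hΦval : ∀ x ∈ Ω, Φ x = fieldVal (jetAt f u g x) C := fun x hx => hC x (subset_closure hx)
  have hfd : ∀ x ∈ cellInteriors 𝒯, ∀ a, DifferentiableAt ℝ (f a) x := fun x hx a =>
    (hf a).2.differentiableAt hx
  have hQder : ∀ x ∈ Ω, x ∈ cellInteriors 𝒯 →
      HasPartials Q x (tfDer (jetAt f u g x) c₀) := fun x hx hx' => by
    have h := hasPartials_of_eventuallyEq (hfd x hx') (F := Q) (C := fun a => tfSym (c₀ a))
      (by filter_upwards [hΩ.mem_nhds hx] with y hy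
          rw [hQval y hy, tfVal_eq_sum]
          rfl)
    convert h using 1
    funext k
    exact tfDer_eq_sum (jetAt f u g x) _ _
  have hQ'der : ∀ x ∈ cellInteriors 𝒯, HasPartials (fun x => ∑ a, f a x • tfSym (s.1 a)) x
      (tfDer (jetAt f u g x) s.1) := fun x hx' => by
    have h := hasPartials_of_eventuallyEq (hfd x hx') (F := fun x => ∑ a, f a x • tfSym (s.1 a))
      (C := fun a => tfSym (s.1 a)) (Eventually.of_forall fun y => rfl)
    convert h using 1
    funext k
    exact tfDer_eq_sum (jetAt f u g x) _ _
  have hΦder : ∀ x ∈ Ω, x ∈ cellInteriors 𝒯 →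
      HasPartials Φ x (fieldDer (jetAt f u g x) C) := fun x hx hx' =>
    hasPartials_of_eventuallyEq (hfd x hx') (F := Φ) (C := C)
      (by filter_upwards [hΩ.mem_nhds hx] with y hy using hC y (subset_closure hy))
  have hgrad : ∀ x ∈ cellInteriors 𝒯, grad (fun x => (∑ a, s.2 a * f a x) + g x) x =
      potGrad (jetAt f u g x) s.2 + grad g x := fun x hx => by
    rw [grad_add (differentiableAt_linearCombination (hfd x hx) _) (hg.differentiableAt hx)]
    congr 1
    funext k
    rw [grad, pd_linearCombination (hfd x hx)]
    simp [potGrad, jetAt, grad]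
  -- The left factor lies in the range of the self-adjoint projection, so pairing it with `Φ` or
  -- with its projection gives the same value. The elastic and bulk terms `e₂` and `e₃` follow the
  -- same principle.
  have e₁ : ∫ x in Ω, frob ((1 / p.dt) • ((∑ a, f a x • tfSym (s.1 a)) - Q x)) (Φ x) =
      1 / p.dt * ∫ x in Ω, frob (tfVal (jetAt f u g x) s.1 - tfVal (jetAt f u g x) c₀)
        (tfVal (jetAt f u g x) C) := by
    rw [← integral_const_mul]
    refine integral_congr_ae ?_
    filter_upwards [hgood] with x hx
    rw [hQ'val, hQval x hx.1, hΦval x hx.1, frob_smul_left, tfVal, tfVal, tfVal, ← map_sub,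
      frob_tfSym_left, frob_tfSym_left, tfSym_eq_self (tfSym_isSymm _) (trace_tfSym hd _)]
  have e₂ : ∫ x in Ω, gradM (fun y => (1 / 2 : ℝ) • (Q y + ∑ a, f a y • tfSym (s.1 a))) Φ x =
      1 / 2 * ∫ x in Ω, ∑ k, frob (tfDer (jetAt f u g x) c₀ k + tfDer (jetAt f u g x) s.1 k)
        (tfDer (jetAt f u g x) C k) := by
    rw [← integral_const_mul]
    refine integral_congr_ae ?_
    filter_upwards [hgood] with x hx
    rw [(hQder x hx.1 hx.2).gradM_half (hQ'der x hx.2) (hΦder x hx.1 hx.2)]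
    congr 1
    refine Finset.sum_congr rfl fun k _ => ?_
    rw [tfDer, tfDer, tfDer, ← map_add, frob_tfSym_left, frob_tfSym_left,
      tfSym_eq_self (tfSym_isSymm _) (trace_tfSym hd _)]
  have e₃ : ∫ x in Ω, frob (dF1 p (∑ a, f a x • tfSym (s.1 a)) - dF2 p (Q x)) (Φ x) =
      ∫ x in Ω, frob (dF1 p (tfVal (jetAt f u g x) s.1) - dF2 p (tfVal (jetAt f u g x) c₀))
        (tfVal (jetAt f u g x) C) := by
    refine integral_congr_ae ?_
    filter_upwards [hgood] with x hx
    have h₁ : tfSym (dF1 p (tfVal (jetAt f u g x) s.1)) = dF1 p (tfVal (jetAt f u g x) s.1) :=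
      tfSym_dF1 hd p (tfSym_isSymm _) (trace_tfSym hd _)
    have h₂ : tfSym (dF2 p (tfVal (jetAt f u g x) c₀)) = dF2 p (tfVal (jetAt f u g x) c₀) :=
      tfSym_dF2 p (tfSym_isSymm _) (trace_tfSym hd _)
    have h₃ : tfVal (jetAt f u g x) C = tfSym (fieldVal (jetAt f u g x) C) := rfl
    rw [hQ'val, hQval x hx.1, hΦval x hx.1, h₃, ← frob_tfSym_left, map_sub, h₁, h₂]
  -- Here the scheme itself projects the force, and self-adjointness shifts that projection onto
  -- `Φ`.
  have e₄ : ∫ x in Ω, frob (symPart (Ptilde p (∑ a, f a x • tfSym (s.1 a)) (Q x) ⊙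
        vecMulVec (grad u x) (grad (fun x => (∑ a, s.2 a * f a x) + g x) x))
        - ((1 / d : ℝ) * (Ptilde p (∑ a, f a x • tfSym (s.1 a)) (Q x) ⊙
          vecMulVec (grad u x) (grad (fun x => (∑ a, s.2 a * f a x) + g x) x)).trace)
          • (1 : Mat d)) (Φ x) =
      ∫ x in Ω, frob (Ptilde p (tfVal (jetAt f u g x) s.1) (tfVal (jetAt f u g x) c₀) ⊙
          vecMulVec (jetAt f u g x).2.2.1 (potGrad (jetAt f u g x) s.2 + (jetAt f u g x).2.2.2))
        (tfVal (jetAt f u g x) C) := by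
    refine integral_congr_ae ?_
    filter_upwards [hgood] with x hx
    rw [← tfSym_apply, frob_tfSym_left, hQ'val, hQval x hx.1, hΦval x hx.1, hgrad x hx.2]
    rfl
  have e₅ : ∫ x in Ω, ((grad (fun y => (u y + ((∑ a, s.2 a * f a y) + g y)) / 2) x ⬝ᵥ
        divM (fun y => symPart (Φ y)) x) - (1 / d : ℝ) *
        (grad (fun y => (u y + ((∑ a, s.2 a * f a y) + g y)) / 2) x ⬝ᵥ
          grad (fun y => (Φ y).trace) x)) =
      1 / 2 * ∫ x in Ω, ((jetAt f u g x).2.2.1 + (potGrad (jetAt f u g x) s.2 +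
        (jetAt f u g x).2.2.2)) ⬝ᵥ divA (tfDer (jetAt f u g x) C) := by
    rw [← integral_const_mul]
    refine integral_congr_ae ?_
    filter_upwards [hgood] with x hx
    have hΦx := hΦder x hx.1 hx.2
    rw [hΦx.symPart.divM_eq, hΦx.grad_trace, dotProduct_divA_tfSym,
      grad_half (hu.differentiableAt hx.2)
        ((differentiableAt_linearCombination (hfd x hx.2) _).fun_add (hg.differentiableAt hx.2)),
      hgrad x hx.2, smul_dotProduct, smul_eq_mul]
    rfl
  beta_reduce
  rw [e₁, e₂, e₃, e₄, e₅]
  linarith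

/-- The discrete elliptic equation follows from the equation for the coefficients. -/
theorem uEquation_of_jetForm (hΩ : IsOpen Ω) (h𝒯 : IsTriangulation 𝒯 Ω) {p : Params}
    (hM : p.M ≠ 0) {f : Fin m → Pt d → ℝ} (hf : ∀ a, f a ∈ Yh Ω 𝒯)
    (hspan : ∀ v ∈ Yh Ω 𝒯, ∃ w : Fin m → ℝ, ∀ x ∈ closure Ω, v x = ∑ a, w a * f a x)
    {u g : Pt d → ℝ} (hg : IsPiecewiseP1 𝒯 g) {c₀ : Fin m → Mat d} {s : Coeff d m}
    (hs : ∀ y, ∫ x in Ω, jetForm p c₀ s y (jetAt f u g x) = 0) :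
    uEquation p Ω 𝒯 (fun x => ∑ a, f a x • tfSym (s.1 a))
      (fun x => (∑ a, s.2 a * f a x) + g x) := by
  intro ψ hψ
  obtain ⟨w, hw⟩ := hspan ψ hψ
  -- A zero tensor test field isolates the elliptic equation, whose weight `M / 2` is then divided
  -- out.
  have hsum := hs (0, w)
  simp only [jetForm_potential] at hsum
  rw [integral_const_mul] at hsum
  have hsum' := (mul_eq_zero.1 hsum).resolve_left (div_ne_zero hM two_ne_zero)
  rw [← hsum']
  refine integral_congr_ae ?_
  filter_upwards [ae_restrict_mem hΩ.measurableSet, h𝒯.ae_mem_cellInteriors hΩ] with x hx hx'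
  have hfd : ∀ a, DifferentiableAt ℝ (f a) x := fun a => (hf a).2.differentiableAt hx'
  have hcomb : ∀ w : Fin m → ℝ, grad (fun y => ∑ a, w a * f a y) x =
      potGrad (jetAt f u g x) w := fun w => by
    funext k
    rw [grad, pd_linearCombination hfd]
    simp [potGrad, jetAt, grad]
  have hψx : grad ψ x = potGrad (jetAt f u g x) w := by
    rw [← hcomb]
    funext k
    refine pd_congr ?_ k
    filter_upwards [hΩ.mem_nhds hx] with y hy using hw y (subset_closure hy)
  have hQ' : divM (fun x => ∑ a, f a x • tfSym (s.1 a)) x = divA (tfDer (jetAt f u g x) s.1) := by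
    have h := hasPartials_of_eventuallyEq hfd (F := fun x => ∑ a, f a x • tfSym (s.1 a))
      (C := fun a => tfSym (s.1 a)) (Eventually.of_forall fun y => rfl)
    rw [h.divM_eq]
    congr 1
    funext k
    exact (tfDer_eq_sum (jetAt f u g x) s.1 k).symm
  rw [grad_add (differentiableAt_linearCombination hfd _) (hg.differentiableAt hx'), hcomb, hψx,
    hQ', tfVal_eq_sum]
  rfl

/-- One time step of the scheme has a solution with symmetric trace-free values. -/
theorem exists_isStep (hd : d ≠ 0) (hΩ : IsOpen Ω) (h𝒯 : IsTriangulation 𝒯 Ω) {p : Params}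
    (hL : 0 < p.L) (hM : 0 < p.M) (hR : 0 < p.R) (hdt : 0 < p.dt) (heps : 0 < p.eps)
    (hφ : IsMollifier p.φ p.eps) (hβ₁ : |p.b| ≤ p.β₁) (hβ₂ : |p.b| ≤ p.β₂)
    (hε : |p.ε₂| * p.R < p.ε₁) {g g' : Pt d → ℝ} (hg : g ∈ Wh Ω 𝒯) (hg' : g' ∈ Wh Ω 𝒯)
    {Q : Pt d → Mat d} (hQ : Q ∈ Xh Ω 𝒯) (hQt : IsQTensor Ω Q) {v : Pt d → ℝ} (hv : v ∈ Yh Ω 𝒯) :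
    ∃ Q' v', IsStep p Ω 𝒯 g g' Q v Q' v' ∧ IsQTensor Ω Q' := by
  have := h𝒯.isFiniteMeasure
  obtain ⟨m, f, hf, hspan⟩ := h𝒯.exists_family
  obtain ⟨c₀, hc₀⟩ := exists_coeff_of_mem_Xh hspan hQ
  have hu : IsPiecewiseP1 𝒯 fun x => v x + g x := hv.2.add hg.2
  obtain ⟨r, hr⟩ := exists_ae_bound_jetAt h𝒯 hΩ (fun a => (hf a).2) hu hg'.2
  obtain ⟨s, hs⟩ := exists_jet_solution hd hL hM hR hdt heps hφ hβ₁ hβ₂ hε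
    (aestronglyMeasurable_jetAt (fun a => (hf a).1.1.1.1) _ g') hr c₀
  -- The projection is applied to the coefficients, so the new field remains in `X_h` and is
  -- symmetric and trace-free at every point.
  refine ⟨fun x => ∑ a, f a x • tfSym (s.1 a), fun x => ∑ a, s.2 a * f a x,
    ⟨fun i j => ?_, sum_mem_Yh hf _, ?_, ?_⟩, fun x _ => ?_⟩
  · have h : (fun x => (∑ a, f a x • tfSym (s.1 a)) i j) =
        fun x => ∑ a, tfSym (s.1 a) i j * f a x := by
      funext x
      simp [Matrix.sum_apply, mul_comm]
    rw [h]
    exact sum_mem_Yh hf _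
  · exact qEquation_of_jetForm hd hΩ h𝒯 (contDiff_trunc hR.le heps.le hφ d) hf hspan hu hg'.2 hQt
      hc₀ hs
  · exact uEquation_of_jetForm hΩ h𝒯 hM.ne' hf hspan hg'.2 hs
  · have h : ∑ a, f a x • tfSym (s.1 a) = tfSym (∑ a, f a x • s.1 a) := by simp
    simp only [h]
    exact ⟨tfSym_isSymm _, trace_tfSym hd _⟩

end Step

end

end QTensorScheme

/-! ### Iteration over the time steps. -/

theorem mainTheorem2
    (d : ℕ) (hd : d = 2 ∨ d = 3)
    (Ω : Set (QTensorScheme.Pt d)) (hΩ : IsOpen Ω)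
    (𝒯 : Geometry.SimplicialComplex ℝ (QTensorScheme.Pt d))
    (h𝒯 : QTensorScheme.IsTriangulation 𝒯 Ω)
    (p : QTensorScheme.Params)
    (hc : 0 < p.c) (hL : 0 < p.L) (hM : 0 < p.M) (hR : 0 < p.R) (hdt : 0 < p.dt)
    (heps : 0 < p.eps) (hφ : QTensorScheme.IsMollifier p.φ p.eps)
    (hβ₁ : max |p.b| p.a ≤ p.β₁) (hβ₂ : max |p.b| p.c ≤ p.β₂)
    (C : ℝ) (hC : 0 < C)
    (hdiv : ∀ Φ ∈ QTensorScheme.Xh Ω 𝒯,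
      ∫ x in Ω, (QTensorScheme.divM Φ x ⬝ᵥ QTensorScheme.divM Φ x) ≤
        C * ∫ x in Ω, QTensorScheme.gradM Φ Φ x)
    (hε₁ : max (2 * |p.ε₂| * (p.R + p.R ^ 2)) (2 * |p.ε₃|) < p.ε₁)
    (hε₃ : |p.ε₃| < p.L / (3 * C))
    (N : ℕ) (g : ℕ → QTensorScheme.Pt d → ℝ) (hg : ∀ n ≤ N, g n ∈ QTensorScheme.Wh Ω 𝒯) :
    (∀ n < N, ∀ Q ∈ QTensorScheme.Xh Ω 𝒯, QTensorScheme.IsQTensor Ω Q →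
      ∀ v ∈ QTensorScheme.Yh Ω 𝒯,
        ∃ (Q' : QTensorScheme.Pt d → QTensorScheme.Mat d) (v' : QTensorScheme.Pt d → ℝ),
          QTensorScheme.IsStep p Ω 𝒯 (g n) (g (n + 1)) Q v Q' v' ∧
            QTensorScheme.IsQTensor Ω Q') ∧
    (∀ Q₀ ∈ QTensorScheme.Xh Ω 𝒯, QTensorScheme.IsQTensor Ω Q₀ →
      ∀ v₀ ∈ QTensorScheme.Yh Ω 𝒯,
        ∃ (Q : ℕ → QTensorScheme.Pt d → QTensorScheme.Mat d) (v : ℕ → QTensorScheme.Pt d → ℝ),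
          Q 0 = Q₀ ∧ v 0 = v₀ ∧
            ∀ n < N, QTensorScheme.IsStep p Ω 𝒯 (g n) (g (n + 1)) (Q n) (v n)
              (Q (n + 1)) (v (n + 1))) := by
  have hd' : d ≠ 0 := by rcases hd with rfl | rfl <;> norm_num
  have hε : |p.ε₂| * p.R < p.ε₁ := by
    refine lt_of_le_of_lt ?_ ((le_max_left _ _).trans_lt hε₁)
    nlinarith [mul_nonneg (abs_nonneg p.ε₂) hR.le, mul_nonneg (abs_nonneg p.ε₂) (sq_nonneg p.R)]
  have step : ∀ n < N, ∀ Q ∈ QTensorScheme.Xh Ω 𝒯, QTensorScheme.IsQTensor Ω Q →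
      ∀ v ∈ QTensorScheme.Yh Ω 𝒯,
        ∃ (Q' : QTensorScheme.Pt d → QTensorScheme.Mat d) (v' : QTensorScheme.Pt d → ℝ),
          QTensorScheme.IsStep p Ω 𝒯 (g n) (g (n + 1)) Q v Q' v' ∧
            QTensorScheme.IsQTensor Ω Q' := fun n hn Q hQ hQt v hv =>
    QTensorScheme.exists_isStep hd' hΩ h𝒯 hL hM hR hdt heps hφ ((le_max_left _ _).trans hβ₁)
      ((le_max_left _ _).trans hβ₂) hε (hg n hn.le) (hg (n + 1) hn) hQ hQt hv
  refine ⟨step, fun Q₀ hQ₀ hQt₀ v₀ hv₀ => ?_⟩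
  -- The recursion runs on admissible states, so that symmetry and vanishing trace are available to
  -- the next step.
  let S := {s : (QTensorScheme.Pt d → QTensorScheme.Mat d) × (QTensorScheme.Pt d → ℝ) //
    s.1 ∈ QTensorScheme.Xh Ω 𝒯 ∧ QTensorScheme.IsQTensor Ω s.1 ∧ s.2 ∈ QTensorScheme.Yh Ω 𝒯}
  have next : ∀ (n : ℕ) (s : S), ∃ t : S, n < N →
      QTensorScheme.IsStep p Ω 𝒯 (g n) (g (n + 1)) s.1.1 s.1.2 t.1.1 t.1.2 := fun n s => by
    by_cases hn : n < N
    · obtain ⟨Q', v', h, hQt'⟩ := step n hn _ s.2.1 s.2.2.1 _ s.2.2.2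
      exact ⟨⟨(Q', v'), h.1, hQt', h.2.1⟩, fun _ => h⟩
    -- From time `N` on nothing is required, and the state is simply kept.
    · exact ⟨s, fun h => absurd h hn⟩
  choose F hF using next
  let σ : ℕ → S := fun n => Nat.rec ⟨(Q₀, v₀), hQ₀, hQt₀, hv₀⟩ F n
  exact ⟨fun n => (σ n).1.1, fun n => (σ n).1.2, rfl, rfl, fun n hn => hF n (σ n) hn⟩
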